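/- Let $(\Delta\phi)(n)=\phi(n+1)+\phi(n-1)-2\phi(n)$ be the discrete Laplacian, a bounded self-adjoint operator on $\ell^2(\mathbb Z)$, and let $e^{-it\Delta^2}$, $t\in\mathbb R$, be the unitary group generated by the discrete bi-Laplacian $\Delta^2$. For $q,r\in[1,\infty]$ put $$\|u\|_{L^q_t\ell^r}=\Big(\int_{\mathbb R}\Big(\sum_{n\in\mathbb Z}|u(t,n)|^r\Big)^{q/r}dt\Big)^{1/q},$$ with the usual modification if $q=\infty$ or $r=\infty$. Call $(q,r)\in[2,\infty]^2$ admissible if $(q,r)\neq(2,\infty)$ and $\frac1q+\frac1{4r}\le\frac18$. (i) Let $(q,r)$ and $(\tilde q,\tilde r)$ be admissible, and let $\tilde q',\tilde r'$ be the exponents dual to $\tilde q,\tilde r$. There is a finite constant $C$, depending only on $q,r,\tilde q,\tilde r$, such that every solution $u$ of the inhomogeneous discrete bi-Schrödinger equation $$i(\partial_tu)(t,n)-(\Delta^2u)(t,n)+F(t,n)=0,\qquad (t,n)\in\mathbb R\times\mathbb Z,$$ with initial value $u(0,\cdot)\in\ell^2(\mathbb Z)$ satisfies $$\|u\|_{L^q_t\ell^r}\le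 C\big(\|u(0,\cdot)\|_{\ell^2}+\|F\|_{L^{\tilde q'}_t\ell^{\tilde r'}}\big).$$ Here a solution is a function $u\in C(\mathbb R;\ell^2(\mathbb Z))$ such that, for every $n$, $t\mapsto u(t,n)$ is locally absolutely continuous and satisfies the equation for almost every $t$. (ii) The decay estimate $\|e^{-it\Delta^2}\|_{\ell^1\to\ell^\infty}\lesssim|t|^{-1/4}$, $t\neq0$, is sharp: $\frac14$ is the largest real number $\alpha$ for which there is a constant $C_\alpha$ with $$\|e^{-it\Delta^2}\phi\|_{\ell^\infty}\le C_\alpha|t|^{-\alpha}\|\phi\|_{\ell^1}\qquad\text{for all }t\neq0\text{ and all }\phi\in\ell^1(\mathbb Z).$$ In particular no such estimate holds with $\alpha>\frac14$. -/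

import Mathlib

open MeasureTheory
open scoped ENNReal NNReal

namespace BiSchrodinger

noncomputable section

/-- The Hilbert space `ℓ²(ℤ)` of complex sequences. -/
abbrev EllTwo : Type := lp (fun _ : ℤ => ℂ) 2

theorem memEllTwo_shift (k : ℤ) (φ : EllTwo) :
    Memℓp (fun n : ℤ => (φ : ℤ → ℂ) (n + k)) 2 := by
  have h2 : 0 < (2 : ℝ≥0∞).toReal := by norm_num
  exact memℓp_gen (((lp.memℓp φ).summable h2).comp_injective (add_left_injective k))

/-- The shift `(S_k φ)(n) = φ(n + k)` as an isometry of `ℓ²(ℤ)`. -/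
def shift (k : ℤ) : EllTwo →ₗᵢ[ℂ] EllTwo where
  toFun φ := ⟨fun n => (φ : ℤ → ℂ) (n + k), memEllTwo_shift k φ⟩
  map_add' _ _ := rfl
  map_smul' _ _ := rfl
  norm_map' φ := by
    have h2 : 0 < (2 : ℝ≥0∞).toReal := by norm_num
    rw [lp.norm_eq_tsum_rpow h2, lp.norm_eq_tsum_rpow h2]
    congr 1
    exact (Equiv.addRight k).tsum_eq (fun n => ‖(φ : ℤ → ℂ) n‖ ^ (2 : ℝ≥0∞).toReal)

/-- The discrete Laplacian `(Δφ)(n) = φ(n + 1) + φ(n - 1) - 2φ(n)` as a bounded operator on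
`ℓ²(ℤ)`. -/
def laplacian : EllTwo →L[ℂ] EllTwo :=
  (shift 1).toContinuousLinearMap + (shift (-1)).toContinuousLinearMap
    - (2 : ℂ) • ContinuousLinearMap.id ℂ EllTwo

theorem laplacian_apply (φ : EllTwo) (n : ℤ) :
    (laplacian φ : ℤ → ℂ) n
      = (φ : ℤ → ℂ) (n + 1) + (φ : ℤ → ℂ) (n - 1) - 2 * (φ : ℤ → ℂ) n := rfl

/-- The discrete bi-Laplacian `Δ²`. -/
def biLaplacian : EllTwo →L[ℂ] EllTwo := laplacian.comp laplacian

/-- The free group `e^{-itΔ²}` on `ℓ²(ℤ)`. -/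
def freeGroup (t : ℝ) : EllTwo →L[ℂ] EllTwo :=
  NormedSpace.exp ((-(Complex.I * (t : ℂ))) • biLaplacian)

/-- The `ℓ^r(ℤ)` norm, `0 < r ≤ ∞`, of an arbitrary sequence, with value `∞` outside `ℓ^r`. -/
def ellNorm (r : ℝ≥0∞) (φ : ℤ → ℂ) : ℝ≥0∞ := eLpNorm φ r Measure.count

/-- The mixed norm `‖u‖_{L^q_t ℓ^r} = (∫ (∑ₙ |u(t,n)|^r)^{q/r} dt)^{1/q}`, with the usual
(essential) suprema for `q = ∞` or `r = ∞`. -/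
def mixedNorm (q r : ℝ≥0∞) (u : ℝ → ℤ → ℂ) : ℝ≥0∞ :=
  eLpNorm (fun t => ellNorm r (u t)) q volume

/-- The exponent pairs `(q, r) ≠ (2, ∞)` in `[2, ∞]²` with `1/q + 1/(4r) ≤ 1/8`. -/
def Admissible (q r : ℝ≥0∞) : Prop :=
  2 ≤ q ∧ 2 ≤ r ∧ (q, r) ≠ (2, ∞) ∧ 1 / q + 1 / (4 * r) ≤ 1 / 8

/-- `u ∈ C(ℝ; ℓ²(ℤ))` solves `i ∂ₜu - Δ²u + F = 0`: each `u(·, n)` is locally absolutely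
continuous and satisfies the equation at almost every time. -/
structure IsSolution (u : ℝ → EllTwo) (F : ℝ → ℤ → ℂ) : Prop where
  continuous : Continuous u
  absolutelyContinuous : ∀ (n : ℤ) (a b : ℝ),
    AbsolutelyContinuousOnInterval (fun t => (u t : ℤ → ℂ) n) a b
  equation : ∀ n : ℤ, ∀ᵐ t : ℝ, ∃ v : ℂ,
    HasDerivAt (fun s => (u s : ℤ → ℂ) n) v t ∧
      Complex.I * v - (biLaplacian (u t) : ℤ → ℂ) n + F t n = 0

/-- The dispersive estimate `‖e^{-itΔ²}φ‖_{ℓ^∞} ≤ C |t|^{-α} ‖φ‖_{ℓ¹}` for all `t ≠ 0` and all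
`φ ∈ ℓ¹(ℤ) ⊆ ℓ²(ℤ)`, with some finite constant `C`. -/
def DecayEstimate (α : ℝ) : Prop :=
  ∃ C : ℝ≥0, ∀ t : ℝ, t ≠ 0 → ∀ φ : EllTwo, Memℓp (φ : ℤ → ℂ) 1 →
    ellNorm ∞ (freeGroup t φ : ℤ → ℂ)
      ≤ (C : ℝ≥0∞) * ENNReal.ofReal (|t| ^ (-α)) * ellNorm 1 (φ : ℤ → ℂ)

end

end BiSchrodinger

open MeasureTheory
open scoped ENNReal NNReal

namespace BiSchrodinger

noncomputable section

/-! ### Van der Corput's second-derivative test -/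

/-- The second-derivative test of van der Corput for oscillatory integrals. -/
theorem norm_integral_cexp_le {f f' f'' : ℝ → ℝ} {a b l : ℝ} (hab : a ≤ b) (hl : 0 < l)
    (hf : ∀ x, HasDerivAt f (f' x) x) (hf' : ∀ x, HasDerivAt f' (f'' x) x)
    (hc : Continuous f'') (hlow : ∀ x ∈ Set.Icc a b, l ≤ f'' x) :
    ‖∫ x in a..b, Complex.exp (Complex.I * f x)‖ ≤ 8 / √l := by
  have hsq : 0 < √l := Real.sqrt_pos.2 hl
  have hss : √l * √l = l := Real.mul_self_sqrt hl.le
  have hpos : ∀ x, 0 < f' x ^ 2 + l := fun x => by positivity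
  have hcf : Continuous f := continuous_iff_continuousAt.2 fun x => (hf x).continuousAt
  have hcf' : Continuous f' := continuous_iff_continuousAt.2 fun x => (hf' x).continuousAt
  set e : ℝ → ℂ := fun x => Complex.exp (Complex.I * f x) with he
  have hce : Continuous e := by fun_prop
  have hne : ∀ x, ‖e x‖ = 1 := fun x => by
    simp only [he]; rw [mul_comm]; exact Complex.norm_exp_ofReal_mul_I _
  have hed : ∀ x, HasDerivAt e (Complex.I * f' x * e x) x := fun x => by
    have := (((hf x).ofReal_comp).const_mul Complex.I).cexp
    simpa [he, mul_comm] using this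
  -- A regularised 1/f' that stays bounded at stationary points, so no neighbourhood of them has to
  -- be cut out. With e = exp(if), the remainder ie − (me)' is (i·l/(f'² + l) − m')e, and both terms
  -- are at most f''/(f'² + l), the derivative of arctan(f'/√l)/√l.
  set m : ℝ → ℝ := fun x => f' x / (f' x ^ 2 + l) with hm
  set m' : ℝ → ℝ := fun x => f'' x * (l - f' x ^ 2) / (f' x ^ 2 + l) ^ 2 with hm'
  have hmd : ∀ x, HasDerivAt m (m' x) x := fun x => by
    have h1 := (hf' x).div (((hf' x).pow 2).add_const l) (hpos x).ne'
    refine h1.congr_deriv ?_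
    simp only [hm']
    congr 1
    simp
    ring
  have hcm' : Continuous m' := by
    simp only [hm']
    exact Continuous.div (by fun_prop) (by fun_prop) fun x => (pow_pos (hpos x) 2).ne'
  have hcm : Continuous m := by
    simp only [hm]
    exact Continuous.div (by fun_prop) (by fun_prop) fun x => (hpos x).ne'
  set M' : ℝ → ℂ := fun x => m' x * e x + m x * (Complex.I * f' x * e x) with hM'
  have hMd : ∀ x, HasDerivAt (fun x => (m x : ℂ) * e x) (M' x) x := fun x =>
    (hmd x).ofReal_comp.mul (hed x)
  have hcM' : Continuous M' := by simp only [hM']; fun_prop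
  have hFTC : ∫ x in a..b, M' x = m b * e b - m a * e a :=
    intervalIntegral.integral_eq_sub_of_hasDerivAt (fun x _ => hMd x)
      (hcM'.intervalIntegrable _ _)
  have hmb : ∀ x, ‖(m x : ℂ) * e x‖ ≤ 1 / (2 * √l) := fun x => by
    rw [norm_mul, hne, mul_one, Complex.norm_real, Real.norm_eq_abs, hm]
    simp only
    rw [abs_div, abs_of_pos (hpos x), div_le_div_iff₀ (hpos x) (by positivity)]
    nlinarith [sq_nonneg (|f' x| - √l), sq_abs (f' x)]
  have hRb : ∀ x ∈ Set.Icc a b,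
      ‖Complex.I * e x - M' x‖ ≤ 2 * (f'' x / (f' x ^ 2 + l)) := fun x hx => by
    have hf0 : 0 < f'' x := hl.trans_le (hlow x hx)
    have h1 : Complex.I * e x - M' x
        = ((Complex.I * ((l / (f' x ^ 2 + l) : ℝ) : ℂ)) - (m' x : ℂ)) * e x := by
      have h2 : (1 : ℂ) - m x * f' x = ((l / (f' x ^ 2 + l) : ℝ) : ℂ) := by
        rw [← Complex.ofReal_mul, ← Complex.ofReal_one, ← Complex.ofReal_sub]
        congr 1
        simp only [hm]
        have := (hpos x).ne'
        field_simp
        ring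
      rw [← h2]
      simp only [hM']
      ring
    rw [h1, norm_mul, hne, mul_one]
    refine (norm_sub_le _ _).trans ?_
    rw [norm_mul, Complex.norm_I, one_mul, Complex.norm_real, Complex.norm_real,
      Real.norm_eq_abs, Real.norm_eq_abs, two_mul]
    refine add_le_add ?_ ?_
    · rw [abs_of_pos (div_pos hl (hpos x))]
      exact div_le_div_of_nonneg_right (hlow x hx) (hpos x).le
    · simp only [hm']
      rw [abs_div, abs_mul, abs_of_pos hf0, abs_of_pos (pow_pos (hpos x) 2),
        div_le_div_iff₀ (pow_pos (hpos x) 2) (hpos x), mul_assoc]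
      refine mul_le_mul_of_nonneg_left ?_ hf0.le
      have : |l - f' x ^ 2| ≤ f' x ^ 2 + l := abs_le.2 ⟨by linarith, by nlinarith [sq_nonneg (f' x)]⟩
      nlinarith [hpos x]
  have harct : ∫ x in a..b, f'' x / (f' x ^ 2 + l)
      = Real.arctan (f' b / √l) / √l - Real.arctan (f' a / √l) / √l := by
    refine intervalIntegral.integral_eq_sub_of_hasDerivAt (f := fun x => Real.arctan (f' x / √l) / √l)
      (fun x _ => ?_) ?_
    · have := (((hf' x).div_const (√l)).arctan).div_const (√l)
      refine this.congr_deriv ?_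
      have h0 := (hpos x).ne'
      have h1 : 1 + (f' x / √l) ^ 2 = (f' x ^ 2 + l) / l := by
        rw [div_pow, Real.sq_sqrt hl.le]; field_simp; ring
      rw [h1]
      field_simp
      rw [Real.sq_sqrt hl.le]
      ring
    · exact (Continuous.div hc (by fun_prop) fun x => (hpos x).ne').intervalIntegrable _ _
  have hR : ‖∫ x in a..b, (Complex.I * e x - M' x)‖ ≤ 2 * Real.pi / √l := by
    refine (intervalIntegral.norm_integral_le_of_norm_le hab
      (g := fun x => 2 * (f'' x / (f' x ^ 2 + l)))
      (Filter.Eventually.of_forall fun x hx => hRb x (Set.Ioc_subset_Icc_self hx)) ?_).trans ?_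
    · exact ((Continuous.div hc (by fun_prop)
        fun x => (hpos x).ne').const_mul _ |>.intervalIntegrable _ _)
    · rw [intervalIntegral.integral_const_mul, harct, ← sub_div, mul_div_assoc]
      refine mul_le_mul_of_nonneg_left ?_ (by norm_num)
      refine div_le_div_of_nonneg_right ?_ hsq.le
      linarith [Real.arctan_lt_pi_div_two (f' b / √l), Real.neg_pi_div_two_lt_arctan (f' a / √l)]
  have hsplit : Complex.I * ∫ x in a..b, e x
      = (m b * e b - m a * e a) + ∫ x in a..b, (Complex.I * e x - M' x) := by
    rw [intervalIntegral.integral_sub ((by fun_prop : Continuous fun x => Complex.I * e x).intervalIntegrable _ _)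
      (hcM'.intervalIntegrable _ _), hFTC, intervalIntegral.integral_const_mul]
    ring
  have hfin : ‖∫ x in a..b, e x‖ ≤ (1 / (2 * √l) + 1 / (2 * √l)) + 2 * Real.pi / √l := by
    have : ‖∫ x in a..b, e x‖ = ‖Complex.I * ∫ x in a..b, e x‖ := by simp
    rw [this, hsplit]
    exact (norm_add_le _ _).trans (add_le_add ((norm_sub_le _ _).trans
      (add_le_add (hmb b) (hmb a))) hR)
  refine hfin.trans ?_
  have : 1 / (2 * √l) + 1 / (2 * √l) + 2 * Real.pi / √l = (1 + 2 * Real.pi) / √l := by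
    field_simp; ring
  rw [this]
  exact div_le_div_of_nonneg_right (by linarith [Real.pi_lt_d2]) hsq.le

/-- The version of the second-derivative test insensitive to the sign of the second derivative. -/
theorem norm_integral_cexp_le_of_neg {f f' f'' : ℝ → ℝ} {a b l : ℝ} (hab : a ≤ b) (hl : 0 < l)
    (hf : ∀ x, HasDerivAt f (f' x) x) (hf' : ∀ x, HasDerivAt f' (f'' x) x)
    (hc : Continuous f'') (hlow : ∀ x ∈ Set.Icc a b, f'' x ≤ -l) :
    ‖∫ x in a..b, Complex.exp (Complex.I * f x)‖ ≤ 8 / √l := by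
  have h := norm_integral_cexp_le (f := fun x => - f x) hab hl (fun x => (hf x).neg)
    (fun x => (hf' x).neg) hc.neg (fun x hx => le_neg_of_le_neg (hlow x hx))
  have h2 : ∫ x in a..b, Complex.exp (Complex.I * f x)
      = (starRingEnd ℂ) (∫ x in a..b, Complex.exp (Complex.I * ((- f x : ℝ) : ℂ))) := by
    rw [← Complex.conjCLE_apply, ← ContinuousLinearEquiv.coe_coe,
      ← ContinuousLinearMap.intervalIntegral_comp_comm]
    · refine intervalIntegral.integral_congr fun x _ => ?_
      simp [← Complex.exp_conj]
    · have hcf : Continuous f := continuous_iff_continuousAt.2 fun x => (hf x).continuousAt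
      exact (by fun_prop : Continuous fun x => Complex.exp
        (Complex.I * ((- f x : ℝ) : ℂ))).intervalIntegrable _ _
  rw [h2, RCLike.norm_conj]
  exact h

/-! ### Size of the second derivative of the phase -/

theorem two_div_pi_mul_le_sin {y η : ℝ} (hη : 0 ≤ η) (h1 : η ≤ y) (h2 : y ≤ Real.pi - η) :
    2 / Real.pi * η ≤ Real.sin y := by
  have hp : 0 ≤ 2 / Real.pi := by positivity
  rcases le_total y (Real.pi / 2) with h | h
  · exact (mul_le_mul_of_nonneg_left h1 hp).trans (Real.mul_le_sin (hη.trans h1) h)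
  · rw [← Real.sin_pi_sub]
    exact (mul_le_mul_of_nonneg_left (by linarith) hp).trans
      (Real.mul_le_sin (by linarith) (by linarith))

/-- The left side is the second derivative of the symbol; the factored form exhibits its zeros,
double at 0 and simple at ±2π/3. -/
theorem cos_sub_cos_two_mul (ξ : ℝ) :
    8 * Real.cos ξ - 8 * Real.cos (2 * ξ) = 16 * (Real.sin (3 * ξ / 2) * Real.sin (ξ / 2)) := by
  have := Real.cos_sub_cos ξ (2 * ξ)
  rw [← mul_sub, this, show (ξ + 2 * ξ) / 2 = 3 * ξ / 2 by ring,
    show (ξ - 2 * ξ) / 2 = -(ξ / 2) by ring, Real.sin_neg]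
  ring

/-- The two Jordan bounds multiply to 3δ²/π², and π² ≤ 12 turns sixteen times this into 4δ². -/
theorem four_mul_sq_le {δ x y : ℝ} (hδ : 0 ≤ δ) (hx : 2 / Real.pi * (3 * δ / 2) ≤ x)
    (hy : 2 / Real.pi * (δ / 2) ≤ y) : 4 * δ ^ 2 ≤ 16 * (x * y) := by
  have hpi := Real.pi_pos
  have h0 : 0 ≤ 2 / Real.pi * (3 * δ / 2) := by positivity
  have h1 : 0 ≤ 2 / Real.pi * (δ / 2) := by positivity
  have h2 := mul_le_mul hx hy h1 (h0.trans hx)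
  have h3 : 2 / Real.pi * (3 * δ / 2) * (2 / Real.pi * (δ / 2)) = 3 * δ ^ 2 / Real.pi ^ 2 := by
    field_simp
  have h4 : δ ^ 2 / 4 ≤ 3 * δ ^ 2 / Real.pi ^ 2 := by
    rw [div_le_div_iff₀ (by norm_num) (by positivity)]
    have : Real.pi ^ 2 ≤ 12 := by nlinarith [Real.pi_lt_d2, Real.pi_gt_three]
    nlinarith [sq_nonneg δ]
  nlinarith

theorem le_cos_sub_cos_of_mem_left {δ ξ : ℝ} (hδ : 0 ≤ δ) (h1 : δ ≤ ξ)
    (h2 : ξ ≤ 2 * Real.pi / 3 - δ) : 4 * δ ^ 2 ≤ 8 * Real.cos ξ - 8 * Real.cos (2 * ξ) := by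
  rw [cos_sub_cos_two_mul]
  exact four_mul_sq_le hδ (two_div_pi_mul_le_sin (by linarith) (by linarith) (by linarith))
    (two_div_pi_mul_le_sin (by linarith) (by linarith) (by linarith [Real.pi_pos]))

theorem cos_sub_cos_le_of_mem_right {δ ξ : ℝ} (hδ : 0 ≤ δ) (h1 : 2 * Real.pi / 3 + δ ≤ ξ)
    (h2 : ξ ≤ Real.pi) : 8 * Real.cos ξ - 8 * Real.cos (2 * ξ) ≤ -(4 * δ ^ 2) := by
  rw [cos_sub_cos_two_mul]
  have hs : Real.sin (3 * ξ / 2) = - Real.sin (3 * ξ / 2 - Real.pi) := by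
    rw [Real.sin_sub_pi, neg_neg]
  have := four_mul_sq_le hδ (x := Real.sin (3 * ξ / 2 - Real.pi)) (y := Real.sin (ξ / 2))
    (two_div_pi_mul_le_sin (by linarith) (by linarith) (by linarith [Real.pi_pos]))
    (two_div_pi_mul_le_sin (by linarith) (by linarith [Real.pi_pos]) (by linarith [Real.pi_pos]))
  rw [hs]
  linarith

/-- The phase `cξ - t(2 - 2 cos ξ)²` of the free propagator. -/
def phase (t c ξ : ℝ) : ℝ := c * ξ - t * (2 - 2 * Real.cos ξ) ^ 2

theorem phase_eq (t c ξ : ℝ) :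
    phase t c ξ = c * ξ - t * (6 - 8 * Real.cos ξ + 2 * Real.cos (2 * ξ)) := by
  rw [phase, Real.cos_two_mul]; ring

theorem hasDerivAt_phase (t c ξ : ℝ) : HasDerivAt (phase t c)
    (c - t * (8 * Real.sin ξ - 4 * Real.sin (2 * ξ))) ξ := by
  have h0 : phase t c = fun ξ => c * ξ - t * (6 - 8 * Real.cos ξ + 2 * Real.cos (2 * ξ)) :=
    funext (phase_eq t c)
  have h2 : HasDerivAt (fun ξ : ℝ => 2 * ξ) 2 ξ := by simpa using (hasDerivAt_id ξ).const_mul 2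
  rw [h0]
  refine (((hasDerivAt_id ξ).const_mul c).sub ((((Real.hasDerivAt_cos ξ).const_mul 8).const_sub 6
    |>.add ((h2.cos).const_mul 2)).const_mul t)).congr_deriv ?_
  ring

theorem hasDerivAt_deriv_phase (t c ξ : ℝ) :
    HasDerivAt (fun ξ => c - t * (8 * Real.sin ξ - 4 * Real.sin (2 * ξ)))
      (-(t * (8 * Real.cos ξ - 8 * Real.cos (2 * ξ)))) ξ := by
  have h2 : HasDerivAt (fun ξ : ℝ => 2 * ξ) 2 ξ := by simpa using (hasDerivAt_id ξ).const_mul 2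
  refine (((((Real.hasDerivAt_sin ξ).const_mul 8).sub
    ((h2.sin).const_mul 4)).const_mul t).const_sub c).congr_deriv ?_
  ring

theorem continuous_phase (t c : ℝ) : Continuous (phase t c) :=
  continuous_iff_continuousAt.2 fun x => (hasDerivAt_phase t c x).continuousAt

theorem norm_integral_phase_le_of_abs_ge {t c a b l : ℝ} (hab : a ≤ b) (hl : 0 < l)
    (h : (∀ ξ ∈ Set.Icc a b, l ≤ 8 * Real.cos ξ - 8 * Real.cos (2 * ξ)) ∨
      ∀ ξ ∈ Set.Icc a b, 8 * Real.cos ξ - 8 * Real.cos (2 * ξ) ≤ -l) (ht : t ≠ 0) :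
    ‖∫ ξ in a..b, Complex.exp (Complex.I * phase t c ξ)‖ ≤ 8 / √(|t| * l) := by
  have hc : Continuous fun ξ : ℝ => -(t * (8 * Real.cos ξ - 8 * Real.cos (2 * ξ))) := by
    fun_prop
  have hpos : 0 < |t| * l := mul_pos (abs_pos.2 ht) hl
  have up := norm_integral_cexp_le hab hpos (hasDerivAt_phase t c) (hasDerivAt_deriv_phase t c) hc
  have dn := norm_integral_cexp_le_of_neg hab hpos (hasDerivAt_phase t c)
    (hasDerivAt_deriv_phase t c) hc
  rcases lt_or_gt_of_ne ht with ht | ht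
  · rw [abs_of_neg ht] at *
    rcases h with h | h
    · exact up fun x hx => by nlinarith [h x hx]
    · exact dn fun x hx => by nlinarith [h x hx]
  · rw [abs_of_pos ht] at *
    rcases h with h | h
    · exact dn fun x hx => by nlinarith [h x hx]
    · exact up fun x hx => by nlinarith [h x hx]

theorem norm_cexp_phase (t c ξ : ℝ) : ‖Complex.exp (Complex.I * phase t c ξ)‖ = 1 := by
  rw [mul_comm]; exact Complex.norm_exp_ofReal_mul_I _

/-- The intervals within δ of 0 and of 2π/3 are estimated by their lengths δ and 2δ. On the two
remaining ones the second derivative is at least 4δ²|t| = (2/δ)² in size, so van der Corput gives 4δ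
each; the sum is 11δ. -/
theorem norm_integral_phase_half_le {t c δ : ℝ} (h0 : 0 < δ) (h1 : δ ≤ 1) (htδ : |t| * δ ^ 4 = 1) :
    ‖∫ ξ in (0 : ℝ)..Real.pi, Complex.exp (Complex.I * phase t c ξ)‖ ≤ 11 * δ := by
  have ht : t ≠ 0 := by rintro rfl; simp at htδ
  have hpi := Real.pi_gt_three
  have hi : ∀ a b : ℝ, IntervalIntegrable (fun ξ => Complex.exp (Complex.I * phase t c ξ))
      volume a b := fun a b =>
    (by have := continuous_phase t c; fun_prop :
      Continuous fun ξ => Complex.exp (Complex.I * phase t c ξ)).intervalIntegrable a b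
  have hs : √(|t| * (4 * δ ^ 2)) = 2 / δ := by
    rw [show |t| * (4 * δ ^ 2) = (2 / δ) ^ 2 by field_simp; linarith]
    exact Real.sqrt_sq (by positivity)
  have hv : (8 : ℝ) / (2 / δ) = 4 * δ := by field_simp; norm_num
  have hb : ∀ a b : ℝ, a ≤ b →
      ‖∫ ξ in a..b, Complex.exp (Complex.I * phase t c ξ)‖ ≤ b - a := fun a b hab => by
    refine (intervalIntegral.norm_integral_le_of_norm_le_const (C := 1)
      fun x _ => (norm_cexp_phase t c x).le).trans ?_
    rw [one_mul, abs_of_nonneg (by linarith)]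
  have I1 := hb 0 δ h0.le
  have I2 := norm_integral_phase_le_of_abs_ge (c := c) (t := t) (a := δ)
    (b := 2 * Real.pi / 3 - δ) (l := 4 * δ ^ 2) (by linarith) (by positivity)
    (Or.inl fun ξ hξ => le_cos_sub_cos_of_mem_left h0.le hξ.1 hξ.2) ht
  have I3 := hb (2 * Real.pi / 3 - δ) (2 * Real.pi / 3 + δ) (by linarith)
  have I4 := norm_integral_phase_le_of_abs_ge (c := c) (t := t) (a := 2 * Real.pi / 3 + δ)
    (b := Real.pi) (l := 4 * δ ^ 2) (by linarith) (by positivity)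
    (Or.inr fun ξ hξ => cos_sub_cos_le_of_mem_right h0.le hξ.1 hξ.2) ht
  rw [hs, hv] at I2 I4
  rw [← intervalIntegral.integral_add_adjacent_intervals (hi 0 δ) (hi δ Real.pi),
    ← intervalIntegral.integral_add_adjacent_intervals (hi δ (2 * Real.pi / 3 - δ)) (hi _ Real.pi),
    ← intervalIntegral.integral_add_adjacent_intervals
      (hi (2 * Real.pi / 3 - δ) (2 * Real.pi / 3 + δ)) (hi _ Real.pi)]
  refine (norm_add_le _ _).trans ((add_le_add I1 ((norm_add_le _ _).trans (add_le_add I2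
    ((norm_add_le _ _).trans (add_le_add I3 I4))))).trans ?_)
  linarith

theorem norm_integral_phase_le {t c δ : ℝ} (h0 : 0 < δ) (h1 : δ ≤ 1) (htδ : |t| * δ ^ 4 = 1) :
    ‖∫ ξ in (-Real.pi)..Real.pi, Complex.exp (Complex.I * phase t c ξ)‖ ≤ 22 * δ := by
  have hi : ∀ a b : ℝ, IntervalIntegrable (fun ξ => Complex.exp (Complex.I * phase t c ξ))
      volume a b := fun a b =>
    (by have := continuous_phase t c; fun_prop :
      Continuous fun ξ => Complex.exp (Complex.I * phase t c ξ)).intervalIntegrable a b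
  have hneg : ∫ ξ in (-Real.pi)..0, Complex.exp (Complex.I * phase t c ξ)
      = ∫ ξ in (0 : ℝ)..Real.pi, Complex.exp (Complex.I * phase t (-c) ξ) := by
    have := intervalIntegral.integral_comp_neg (a := 0) (b := Real.pi)
      (fun ξ => Complex.exp (Complex.I * phase t c ξ))
    rw [neg_zero] at this
    rw [← this]
    refine intervalIntegral.integral_congr fun ξ _ => ?_
    simp [phase]
  rw [← intervalIntegral.integral_add_adjacent_intervals (hi (-Real.pi) 0) (hi 0 Real.pi), hneg]
  refine (norm_add_le _ _).trans ((add_le_add (norm_integral_phase_half_le h0 h1 htδ)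
    (norm_integral_phase_half_le h0 h1 htδ)).trans ?_)
  linarith

/-! ### Pointwise decay of the kernel -/

/-- The convolution kernel of `e^{-itΔ²}`. -/
def kernel (t : ℝ) (k : ℤ) : ℂ :=
  (2 * Real.pi : ℂ)⁻¹ * ∫ ξ in (-Real.pi)..Real.pi, Complex.exp (Complex.I * phase t k ξ)

theorem norm_kernel_le {t : ℝ} (ht : t ≠ 0) (k : ℤ) : ‖kernel t k‖ ≤ 4 * |t| ^ (-(1 / 4) : ℝ) := by
  have hpi := Real.pi_gt_three
  have hn : ‖(2 * Real.pi : ℂ)⁻¹‖ = (2 * Real.pi)⁻¹ := by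
    rw [norm_inv, norm_mul, Complex.norm_real, Real.norm_of_nonneg Real.pi_pos.le]; norm_num
  have habs := abs_pos.2 ht
  rw [kernel, norm_mul, hn, inv_mul_le_iff₀ (by positivity)]
  rcases le_total 1 |t| with h | h
  · refine (norm_integral_phase_le (δ := |t| ^ (-(1 / 4) : ℝ)) (by positivity)
      (Real.rpow_le_one_of_one_le_of_nonpos h (by norm_num)) ?_).trans ?_
    · rw [← Real.rpow_natCast, ← Real.rpow_mul habs.le]
      norm_num
      rw [Real.rpow_neg_one, mul_inv_cancel₀ habs.ne']
    · have : 0 < |t| ^ (-(1 / 4) : ℝ) := by positivity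
      nlinarith
  -- For |t| ≤ 1 the choice δ = |t|^{-1/4} would violate δ ≤ 1, but the trivial bound 2π on the
  -- integral is then enough.
  · have h1 : 1 ≤ |t| ^ (-(1 / 4) : ℝ) :=
      Real.one_le_rpow_of_pos_of_le_one_of_nonpos habs h (by norm_num)
    refine (intervalIntegral.norm_integral_le_of_norm_le_const (C := 1)
      fun x _ => (norm_cexp_phase t k x).le).trans ?_
    rw [one_mul, abs_of_nonneg (by linarith)]
    nlinarith

/-! ### The free group -/

theorem inner_shift (k : ℤ) (x y : EllTwo) :
    inner ℂ (shift k x) y = inner ℂ x (shift (-k) y) := by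
  rw [lp.inner_eq_tsum, lp.inner_eq_tsum,
    ← (Equiv.addRight k).tsum_eq (fun n => inner ℂ ((x : ℤ → ℂ) n) ((shift (-k) y : ℤ → ℂ) n))]
  refine tsum_congr fun n => ?_
  change inner ℂ ((x : ℤ → ℂ) (n + k)) ((y : ℤ → ℂ) n)
    = inner ℂ ((x : ℤ → ℂ) (n + k)) ((y : ℤ → ℂ) (n + k + -k))
  rw [add_neg_cancel_right]

theorem inner_laplacian (x y : EllTwo) : inner ℂ (laplacian x) y = inner ℂ x (laplacian y) := by
  have h : ∀ z : EllTwo, laplacian z = shift 1 z + shift (-1) z - (2 : ℂ) • z := fun _ => rfl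
  rw [h, h, inner_sub_left, inner_add_left, inner_sub_right, inner_add_right, inner_shift,
    inner_shift, inner_smul_left, inner_smul_right, neg_neg, map_ofNat]
  ring

theorem inner_biLaplacian (x y : EllTwo) :
    inner ℂ (biLaplacian x) y = inner ℂ (laplacian x) (laplacian y) := by
  rw [biLaplacian, ContinuousLinearMap.comp_apply, inner_laplacian]

theorem isSelfAdjoint_biLaplacian : IsSelfAdjoint biLaplacian := by
  rw [ContinuousLinearMap.isSelfAdjoint_iff_isSymmetric]
  intro x y
  change inner ℂ (biLaplacian x) y = inner ℂ x (biLaplacian y)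
  rw [inner_biLaplacian, inner_laplacian, biLaplacian, ContinuousLinearMap.comp_apply]

/-- Isolates the real parameter, so that the calculus of real one-parameter exponentials applies. -/
theorem freeGroup_eq_exp_smul (t : ℝ) :
    freeGroup t = NormedSpace.exp (t • ((-Complex.I) • biLaplacian)) := by
  rw [freeGroup]
  congr 1
  ext x n
  change -(Complex.I * (t : ℂ)) * (biLaplacian x : ℤ → ℂ) n
    = (t : ℂ) * (-Complex.I * (biLaplacian x : ℤ → ℂ) n)
  ring

theorem freeGroup_zero : freeGroup 0 = 1 := by
  simp [freeGroup_eq_exp_smul]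

theorem freeGroup_add (s t : ℝ) : freeGroup (s + t) = freeGroup s * freeGroup t := by
  simp only [freeGroup_eq_exp_smul]
  let +nondep : NormedAlgebra ℚ (EllTwo →L[ℂ] EllTwo) := .restrictScalars ℚ ℂ _
  rw [add_smul, NormedSpace.exp_add_of_commute]
  exact ((Commute.refl _).smul_left s).smul_right t

theorem freeGroup_add_apply (s t : ℝ) (x : EllTwo) :
    freeGroup (s + t) x = freeGroup s (freeGroup t x) := by
  rw [freeGroup_add]; rfl

theorem hasDerivAt_freeGroup (t : ℝ) :
    HasDerivAt freeGroup (freeGroup t * ((-Complex.I) • biLaplacian)) t := by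
  have h : freeGroup = fun t : ℝ => NormedSpace.exp (t • ((-Complex.I) • biLaplacian)) :=
    funext freeGroup_eq_exp_smul
  rw [h]
  exact hasDerivAt_exp_smul_const (𝕂 := ℝ) ((-Complex.I) • biLaplacian) t

theorem continuous_freeGroup : Continuous freeGroup :=
  continuous_iff_continuousAt.2 fun t => (hasDerivAt_freeGroup t).continuousAt

theorem star_freeGroup (t : ℝ) : star (freeGroup t) = freeGroup (-t) := by
  let +nondep : NormedAlgebra ℚ (EllTwo →L[ℂ] EllTwo) := .restrictScalars ℚ ℂ _
  rw [freeGroup, freeGroup, NormedSpace.star_exp, star_smul, isSelfAdjoint_biLaplacian.star_eq]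
  simp

theorem inner_freeGroup_left (t : ℝ) (x y : EllTwo) :
    inner ℂ (freeGroup t x) y = inner ℂ x (freeGroup (-t) y) := by
  rw [← star_freeGroup, ContinuousLinearMap.star_eq_adjoint, ContinuousLinearMap.adjoint_inner_right]

theorem freeGroup_neg_apply_self (t : ℝ) (x : EllTwo) : freeGroup (-t) (freeGroup t x) = x := by
  rw [← freeGroup_add_apply, neg_add_cancel, freeGroup_zero]; rfl

theorem freeGroup_apply_neg (t : ℝ) (x : EllTwo) : freeGroup t (freeGroup (-t) x) = x := by
  rw [← freeGroup_add_apply, add_neg_cancel, freeGroup_zero]; rfl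

theorem norm_freeGroup_apply (t : ℝ) (x : EllTwo) : ‖freeGroup t x‖ = ‖x‖ := by
  have h : inner ℂ (freeGroup t x) (freeGroup t x) = inner ℂ x x := by
    rw [inner_freeGroup_left, freeGroup_neg_apply_self]
  rw [@norm_eq_sqrt_re_inner ℂ, h, ← @norm_eq_sqrt_re_inner ℂ]

/-! ### The kernel of the free group -/

theorem hasSum_of_forall_eq {ι : Type*} {f g : ι → ℂ} {a : ℂ} (h : ∀ k, f k = g k)
    (hg : HasSum g a) : HasSum f a := by
  rwa [funext h]

/-- The Fourier integral of a continuous symbol. -/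
def fourierInt (g : ℝ → ℂ) (k : ℤ) : ℂ :=
  (2 * Real.pi : ℂ)⁻¹ * ∫ ξ in (-Real.pi)..Real.pi, g ξ * Complex.exp (Complex.I * (k * ξ))

/-- A shift by ±1 multiplies the integrand by e^{±iξ}, so Δ acts as multiplication by 2cos ξ − 2.
Working with vectors whose coordinates are explicit Fourier integrals avoids a Fourier isomorphism
on ℓ². -/
theorem laplacian_apply_of_eq_fourierInt {g : ℝ → ℂ} (hg : Continuous g) {x : EllTwo} {m : ℤ}
    (hx : ∀ n, (x : ℤ → ℂ) n = fourierInt g (n - m)) (n : ℤ) :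
    (laplacian x : ℤ → ℂ) n = fourierInt (fun ξ => (2 * Real.cos ξ - 2 : ℝ) * g ξ) (n - m) := by
  have hi : ∀ k : ℤ, IntervalIntegrable (fun ξ => g ξ * Complex.exp (Complex.I * (k * ξ)))
      volume (-Real.pi) Real.pi := fun k => (by fun_prop :
        Continuous fun ξ : ℝ => g ξ * Complex.exp (Complex.I * (k * ξ))).intervalIntegrable _ _
  rw [laplacian_apply, hx, hx, hx]
  simp only [fourierInt]
  rw [← mul_add, mul_left_comm, ← mul_sub, ← intervalIntegral.integral_add (hi _) (hi _),
    ← intervalIntegral.integral_const_mul,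
    ← intervalIntegral.integral_sub ((hi _).add (hi _)) ((hi _).const_mul _)]
  congr 1
  refine intervalIntegral.integral_congr fun ξ _ => ?_
  have e1 : Complex.exp (Complex.I * (((n + 1 - m : ℤ) : ℂ) * ξ))
      = Complex.exp (Complex.I * (((n - m : ℤ) : ℂ) * ξ)) * Complex.exp (ξ * Complex.I) := by
    rw [← Complex.exp_add]; push_cast; ring_nf
  have e2 : Complex.exp (Complex.I * (((n - 1 - m : ℤ) : ℂ) * ξ))
      = Complex.exp (Complex.I * (((n - m : ℤ) : ℂ) * ξ)) * Complex.exp (-ξ * Complex.I) := by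
    rw [← Complex.exp_add]; push_cast; ring_nf
  have e3 : ((2 * Real.cos ξ - 2 : ℝ) : ℂ)
      = Complex.exp (ξ * Complex.I) + Complex.exp (-ξ * Complex.I) - 2 := by
    push_cast
    rw [Complex.two_cos]
  simp only [e1, e2, e3]
  ring

theorem single_apply_eq_fourierInt (m n : ℤ) :
    (lp.single 2 m (1 : ℂ) : EllTwo) n = fourierInt (fun _ => 1) (n - m) := by
  have hpi : (2 * Real.pi : ℂ) ≠ 0 := by simp [Real.pi_ne_zero]
  rcases eq_or_ne n m with rfl | h
  · rw [lp.single_apply_self, fourierInt]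
    simp only [sub_self, Int.cast_zero, zero_mul, mul_zero, Complex.exp_zero, mul_one,
      intervalIntegral.integral_const, Complex.real_smul]
    field_simp
    push_cast
    ring
  · rw [lp.single_apply_ne _ _ _ h, fourierInt]
    have hk : (((n - m : ℤ) : ℂ)) ≠ 0 := by exact_mod_cast sub_ne_zero.2 h
    have hc : Complex.I * ((n - m : ℤ) : ℂ) ≠ 0 := mul_ne_zero Complex.I_ne_zero hk
    simp only [one_mul, ← mul_assoc]
    rw [integral_exp_mul_complex hc]
    have : Complex.exp (Complex.I * ((n - m : ℤ) : ℂ) * (Real.pi : ℝ))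
        = Complex.exp (Complex.I * ((n - m : ℤ) : ℂ) * ((-Real.pi : ℝ) : ℂ)) := by
      rw [Complex.exp_eq_exp_iff_exists_int]
      exact ⟨n - m, by push_cast; ring⟩
    rw [this]
    simp

theorem biLaplacian_pow_single_apply (k : ℕ) (m n : ℤ) :
    ((biLaplacian ^ k) (lp.single 2 m (1 : ℂ)) : EllTwo) n
      = fourierInt (fun ξ => (((2 - 2 * Real.cos ξ) ^ 2 : ℝ) : ℂ) ^ k) (n - m) := by
  induction k generalizing n with
  | zero => simpa using single_apply_eq_fourierInt m n
  | succ k ih =>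
    rw [pow_succ']
    change (laplacian (laplacian ((biLaplacian ^ k) (lp.single 2 m (1 : ℂ)))) : EllTwo) n = _
    have hg : Continuous fun ξ : ℝ => (((2 - 2 * Real.cos ξ) ^ 2 : ℝ) : ℂ) ^ k := by fun_prop
    rw [laplacian_apply_of_eq_fourierInt (by fun_prop)
      (laplacian_apply_of_eq_fourierInt hg ih) n]
    congr 1
    ext ξ
    push_cast
    ring

/-- The exponential series is evaluated on a delta sequence, one coordinate at a time: its terms are
Fourier integrals of powers of the symbol, and sum and integral are interchanged by dominated
convergence. -/
theorem freeGroup_single_apply (t : ℝ) (m n : ℤ) :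
    (freeGroup t (lp.single 2 m (1 : ℂ)) : ℤ → ℂ) n = kernel t (n - m) := by
  set z : ℂ := -(Complex.I * (t : ℂ)) with hz
  have h1 := NormedSpace.exp_series_hasSum_exp' (𝕂 := ℂ) (z • biLaplacian)
  have h2 := ((h1.mapL (ContinuousLinearMap.apply ℂ EllTwo (lp.single 2 m (1 : ℂ)))).mapL
    (lp.evalCLM ℂ (fun _ : ℤ => ℂ) 2 n))
  have h3 : HasSum (fun k : ℕ => (k.factorial⁻¹ : ℂ) * (z ^ k *
      fourierInt (fun ξ => (((2 - 2 * Real.cos ξ) ^ 2 : ℝ) : ℂ) ^ k) (n - m)))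
      ((freeGroup t (lp.single 2 m (1 : ℂ)) : ℤ → ℂ) n) := by
    refine hasSum_of_forall_eq (fun k => ?_) h2
    rw [smul_pow, ← biLaplacian_pow_single_apply]
    rfl
  refine h3.unique ?_
  have h4 : HasSum (fun k : ℕ => ∫ ξ in (-Real.pi)..Real.pi, (k.factorial⁻¹ : ℂ) *
      ((z * (((2 - 2 * Real.cos ξ) ^ 2 : ℝ) : ℂ)) ^ k * Complex.exp (Complex.I * ((n - m : ℤ) * ξ))))
      (∫ ξ in (-Real.pi)..Real.pi, Complex.exp (Complex.I * phase t (n - m : ℤ) ξ)) := by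
    -- The symbol (2 − 2cos ξ)² takes values in [0, 16].
    refine intervalIntegral.hasSum_integral_of_dominated_convergence
      (fun k _ => (k.factorial : ℝ)⁻¹ * (‖z‖ * 16) ^ k) (fun k => ?_) (fun k => ?_) ?_ ?_ ?_
    · exact (by fun_prop : Continuous _).aestronglyMeasurable
    · refine Filter.Eventually.of_forall fun ξ _ => ?_
      have he : ‖Complex.exp (Complex.I * ((n - m : ℤ) * ξ))‖ = 1 := by
        rw [mul_comm, ← Complex.ofReal_intCast, ← Complex.ofReal_mul]
        exact Complex.norm_exp_ofReal_mul_I _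
      rw [norm_mul, norm_mul, he, mul_one, norm_inv, Complex.norm_natCast, norm_pow, norm_mul,
        Complex.norm_real, Real.norm_of_nonneg (sq_nonneg _)]
      gcongr
      nlinarith [Real.cos_le_one ξ, Real.neg_one_le_cos ξ]
    · refine Filter.Eventually.of_forall fun ξ _ => ?_
      simpa [div_eq_inv_mul] using Real.summable_pow_div_factorial (‖z‖ * 16)
    · exact intervalIntegrable_const
    · refine Filter.Eventually.of_forall fun ξ _ => ?_
      have h5 := (NormedSpace.exp_series_hasSum_exp' (𝕂 := ℂ)
        (z * (((2 - 2 * Real.cos ξ) ^ 2 : ℝ) : ℂ))).mul_right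
          (Complex.exp (Complex.I * ((n - m : ℤ) * ξ)))
      rw [← Complex.exp_eq_exp_ℂ, ← Complex.exp_add] at h5
      have h6 : Complex.I * (phase t (n - m : ℤ) ξ : ℂ)
          = z * (((2 - 2 * Real.cos ξ) ^ 2 : ℝ) : ℂ) + Complex.I * ((n - m : ℤ) * ξ) := by
        simp only [hz, phase]
        push_cast
        ring
      rw [h6]
      exact hasSum_of_forall_eq (fun k => by rw [smul_eq_mul, mul_assoc]) h5
  have h5 := h4.mul_left ((2 * Real.pi : ℂ)⁻¹)
  refine hasSum_of_forall_eq (fun k => ?_) h5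
  rw [intervalIntegral.integral_const_mul, fourierInt]
  simp only [mul_pow, mul_assoc]
  rw [intervalIntegral.integral_const_mul]
  ring

theorem hasSum_freeGroup_apply (t : ℝ) (x : EllTwo) (n : ℤ) :
    HasSum (fun m : ℤ => (x : ℤ → ℂ) m * kernel t (n - m)) ((freeGroup t x : ℤ → ℂ) n) := by
  have h := ((lp.hasSum_single (by norm_num) x).mapL (freeGroup t)).mapL
    (lp.evalCLM ℂ (fun _ : ℤ => ℂ) 2 n)
  refine hasSum_of_forall_eq (fun m => ?_) h
  rw [← freeGroup_single_apply]
  have : (lp.single 2 m ((x : ℤ → ℂ) m) : EllTwo)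
      = (x : ℤ → ℂ) m • (lp.single 2 m (1 : ℂ) : EllTwo) := by
    rw [← lp.single_smul]; simp
  rw [this, map_smul]
  rfl

theorem ellNorm_one (φ : ℤ → ℂ) : ellNorm 1 φ = ∑' n, ‖φ n‖ₑ := by
  rw [ellNorm, eLpNorm_one_eq_lintegral_enorm, lintegral_count]

theorem ellNorm_top (φ : ℤ → ℂ) : ellNorm ∞ φ = ⨆ n, ‖φ n‖ₑ := by
  rw [ellNorm, eLpNorm_exponent_top, eLpNormEssSup, essSup_count]

theorem enorm_freeGroup_apply_le {t : ℝ} (ht : t ≠ 0) (x : EllTwo) (n : ℤ) :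
    ‖(freeGroup t x : ℤ → ℂ) n‖ₑ
      ≤ 4 * ENNReal.ofReal (|t| ^ (-(1 / 4) : ℝ)) * ellNorm 1 (x : ℤ → ℂ) := by
  rw [← (hasSum_freeGroup_apply t x n).tsum_eq]
  refine (enorm_tsum_le_tsum_enorm).trans ?_
  rw [ellNorm_one, ← ENNReal.tsum_mul_left]
  refine ENNReal.tsum_le_tsum fun m => ?_
  rw [enorm_mul, mul_comm]
  gcongr
  rw [← ofReal_norm, show (4 : ℝ≥0∞) = ENNReal.ofReal 4 by norm_num,
    ← ENNReal.ofReal_mul (by norm_num)]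
  exact ENNReal.ofReal_le_ofReal (norm_kernel_le ht _)

theorem decayEstimate_one_fourth : DecayEstimate (1 / 4) :=
  ⟨4, fun t ht φ _ => by
    rw [ellNorm_top]
    exact iSup_le fun n => enorm_freeGroup_apply_le ht φ n⟩

/-! ### Sharpness of the decay rate -/

theorem enorm_inner_le (x y : EllTwo) :
    ‖inner ℂ x y‖ₑ ≤ ellNorm 1 (x : ℤ → ℂ) * ⨆ n, ‖(y : ℤ → ℂ) n‖ₑ := by
  rw [lp.inner_eq_tsum, ellNorm_one, ← ENNReal.tsum_mul_right]
  refine enorm_tsum_le_tsum_enorm.trans (ENNReal.tsum_le_tsum fun n => ?_)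
  have : ‖inner ℂ ((x : ℤ → ℂ) n) ((y : ℤ → ℂ) n)‖ₑ
      = ‖(x : ℤ → ℂ) n‖ₑ * ‖(y : ℤ → ℂ) n‖ₑ := by
    rw [RCLike.inner_apply, enorm_mul, RCLike.enorm_conj, mul_comm]
  rw [this]
  gcongr
  exact le_iSup (fun n => ‖(y : ℤ → ℂ) n‖ₑ) n

theorem laplacian_freeGroup (t : ℝ) (x : EllTwo) :
    laplacian (freeGroup t x) = freeGroup t (laplacian x) := by
  have h : Commute laplacian (freeGroup t) := by
    have h1 : Commute laplacian biLaplacian := by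
      change laplacian * (laplacian * laplacian) = laplacian * laplacian * laplacian
      rw [mul_assoc]
    exact (h1.smul_right _).exp_right
  exact DFunLike.congr_fun h.eq x

theorem hasDerivAt_freeGroup_apply (t : ℝ) (x : EllTwo) :
    HasDerivAt (fun s => freeGroup s x) (freeGroup t ((-Complex.I) • biLaplacian x)) t := by
  have := ((ContinuousLinearMap.apply ℂ EllTwo x).restrictScalars ℝ).hasFDerivAt.comp_hasDerivAt t
    (hasDerivAt_freeGroup t)
  exact this

/-- The derivative of ⟨x, e^{-itΔ²}x⟩ is −i⟨Δx, e^{-itΔ²}Δx⟩ once one Laplacian is moved to the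
left. Only second differences of x enter, so a test vector need not have controlled fourth
differences. -/
theorem norm_inner_freeGroup_sub_le (t : ℝ) (x : EllTwo) :
    ‖inner ℂ x (freeGroup t x) - inner ℂ x x‖ ≤ ‖laplacian x‖ ^ 2 * |t| := by
  have hd : ∀ s : ℝ, HasDerivAt (fun s => inner ℂ x (freeGroup s x))
      (inner ℂ x (freeGroup s ((-Complex.I) • biLaplacian x))) s := fun s => by
    have := ((innerSL ℂ x).restrictScalars ℝ).hasFDerivAt.comp_hasDerivAt s
      (hasDerivAt_freeGroup_apply s x)
    exact this
  have hb : ∀ s : ℝ, ‖inner ℂ x (freeGroup s ((-Complex.I) • biLaplacian x))‖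
      ≤ ‖laplacian x‖ ^ 2 := fun s => by
    rw [map_smul, inner_smul_right, norm_mul, norm_neg, Complex.norm_I, one_mul]
    have h1 : inner ℂ x (freeGroup s (biLaplacian x))
        = inner ℂ (laplacian x) (freeGroup s (laplacian x)) := by
      rw [biLaplacian, ContinuousLinearMap.comp_apply, ← laplacian_freeGroup, inner_laplacian]
    rw [h1]
    refine (norm_inner_le_norm _ _).trans ?_
    rw [norm_freeGroup_apply, sq]
  have := convex_univ.norm_image_sub_le_of_norm_hasDerivWithin_le
    (f := fun s => inner ℂ x (freeGroup s x)) (fun s _ => (hd s).hasDerivWithinAt)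
    (fun s _ => hb s) (Set.mem_univ 0) (Set.mem_univ t)
  simpa [freeGroup_zero] using this

/-- The values `(N² - n²)²₊` of a smooth bump of width `N`. -/
def bumpFun (N : ℕ) (n : ℤ) : ℝ := if |n| ≤ N then ((N : ℝ) ^ 2 - (n : ℝ) ^ 2) ^ 2 else 0

theorem bumpFun_of_abs_le {N : ℕ} {n : ℤ} (h : |n| ≤ N) :
    bumpFun N n = ((N : ℝ) ^ 2 - (n : ℝ) ^ 2) ^ 2 := if_pos h

theorem bumpFun_of_le_abs {N : ℕ} {n : ℤ} (h : (N : ℤ) ≤ |n|) : bumpFun N n = 0 := by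
  rcases h.eq_or_lt with h | h
  · rw [bumpFun_of_abs_le h.ge]
    have : (N : ℝ) ^ 2 = (n : ℝ) ^ 2 := by
      rw [← sq_abs (n : ℝ), ← Int.cast_abs, ← h, Int.cast_natCast]
    rw [this]; simp
  · exact if_neg (not_le.2 h)

/-- Inside, the second difference equals 12n² − 4N² + 2. At |n| = N a single neighbour survives,
with value (2N − 1)²: the double zero of the bump at ±N keeps the edge at order N² as well. -/
theorem abs_bumpFun_laplacian_le {N : ℕ} (hN : 1 ≤ N) (n : ℤ) :
    |bumpFun N (n + 1) + bumpFun N (n - 1) - 2 * bumpFun N n| ≤ 14 * (N : ℝ) ^ 2 := by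
  have hN' : (1 : ℝ) ≤ N := by exact_mod_cast hN
  rcases lt_trichotomy |n| (N : ℤ) with h | h | h
  · have h1 : |n + 1| ≤ N := by rw [abs_lt] at h; rw [abs_le]; omega
    have h2 : |n - 1| ≤ N := by rw [abs_lt] at h; rw [abs_le]; omega
    rw [bumpFun_of_abs_le h1, bumpFun_of_abs_le h2, bumpFun_of_abs_le h.le]
    have hn : (n : ℝ) ^ 2 ≤ (N : ℝ) ^ 2 := by
      have : |(n : ℝ)| ≤ N := by exact_mod_cast h.le
      exact sq_le_sq' (by linarith [(abs_le.1 this).1]) (abs_le.1 this).2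
    push_cast
    rw [abs_le]
    constructor <;> nlinarith [sq_nonneg (n : ℝ)]
  · rw [bumpFun_of_le_abs h.ge, mul_zero, sub_zero]
    have hodd : |(2 * (N : ℝ) - 1) ^ 2| ≤ 14 * (N : ℝ) ^ 2 := by
      rw [abs_of_nonneg (sq_nonneg _)]; nlinarith
    rcases abs_choice n with hn | hn
    · have e : n = N := hn ▸ h
      subst e
      rw [bumpFun_of_le_abs (n := (N : ℤ) + 1) (by rw [abs_of_nonneg] <;> omega),
        bumpFun_of_abs_le (n := (N : ℤ) - 1) (by rw [abs_of_nonneg] <;> omega), zero_add]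
      push_cast
      convert hodd using 2
      ring
    · have e : n = -N := by omega
      subst e
      rw [bumpFun_of_le_abs (n := -(N : ℤ) - 1) (by rw [abs_of_nonpos] <;> omega),
        bumpFun_of_abs_le (n := -(N : ℤ) + 1) (by rw [abs_of_nonpos] <;> omega), add_zero]
      push_cast
      convert hodd using 2
      ring
  · rw [bumpFun_of_le_abs h.le, bumpFun_of_le_abs (n := n + 1), bumpFun_of_le_abs (n := n - 1)]
    · simp
    · rw [lt_abs] at h; rw [le_abs]; omega
    · rw [lt_abs] at h; rw [le_abs]; omega

theorem bumpFun_nonneg (N : ℕ) (n : ℤ) : 0 ≤ bumpFun N n := by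
  unfold bumpFun; split_ifs <;> positivity

theorem bumpFun_le (N : ℕ) (n : ℤ) : bumpFun N n ≤ (N : ℝ) ^ 4 := by
  rcases le_total |n| N with h | h
  · rw [bumpFun_of_abs_le h]
    have hn : (n : ℝ) ^ 2 ≤ (N : ℝ) ^ 2 := by
      have : |(n : ℝ)| ≤ N := by exact_mod_cast h
      exact sq_le_sq' (by linarith [(abs_le.1 this).1]) (abs_le.1 this).2
    nlinarith [sq_nonneg (n : ℝ)]
  · rw [bumpFun_of_le_abs h]; positivity

theorem bumpFun_support {N : ℕ} {n : ℤ} (h : n ∉ Finset.Icc (-(N : ℤ)) N) : bumpFun N n = 0 :=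
  bumpFun_of_le_abs (by rw [Finset.mem_Icc] at h; rw [le_abs]; omega)

/-- The bump as an element of `ℓ²(ℤ)`. -/
def bump (N : ℕ) : EllTwo :=
  ⟨fun n => (bumpFun N n : ℂ), (memℓp_zero ((Finset.Icc (-(N : ℤ)) N).finite_toSet.subset fun n hn => by
    by_contra h
    exact hn (by simp [bumpFun_support h]))).of_exponent_ge zero_le⟩

theorem bump_apply (N : ℕ) (n : ℤ) : (bump N : ℤ → ℂ) n = bumpFun N n := rfl

theorem card_Icc_neg (N : ℕ) : (Finset.Icc (-(N : ℤ)) N).card = 2 * N + 1 := by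
  rw [Int.card_Icc]; omega

theorem memℓp_one_bump (N : ℕ) : Memℓp (bump N : ℤ → ℂ) 1 :=
  (memℓp_zero ((Finset.Icc (-(N : ℤ)) N).finite_toSet.subset fun n hn => by
    by_contra h
    exact hn (by simp [bump_apply, bumpFun_support h]))).of_exponent_ge zero_le

theorem ellNorm_one_bump_le (N : ℕ) :
    ellNorm 1 (bump N : ℤ → ℂ) ≤ ENNReal.ofReal ((2 * N + 1) * (N : ℝ) ^ 4) := by
  rw [ellNorm_one, tsum_eq_sum (s := Finset.Icc (-(N : ℤ)) N)
    fun n hn => by simp [bump_apply, bumpFun_support hn]]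
  refine (Finset.sum_le_card_nsmul _ _ (ENNReal.ofReal ((N : ℝ) ^ 4)) fun n _ => ?_).trans ?_
  · rw [bump_apply, ← ofReal_norm, Complex.norm_real, Real.norm_of_nonneg (bumpFun_nonneg N n)]
    exact ENNReal.ofReal_le_ofReal (bumpFun_le N n)
  · rw [card_Icc_neg, nsmul_eq_mul, ENNReal.ofReal_mul (by positivity)]
    gcongr
    rw [← ENNReal.ofReal_natCast]
    push_cast
    rfl

theorem norm_sq_le_of_support {x : EllTwo} {s : Finset ℤ} {B : ℝ}
    (hs : ∀ n ∉ s, (x : ℤ → ℂ) n = 0) (hB : ∀ n, ‖(x : ℤ → ℂ) n‖ ≤ B) :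
    ‖x‖ ^ 2 ≤ s.card * B ^ 2 := by
  have h := lp.norm_rpow_eq_tsum (p := 2) (by norm_num) x
  simp only [ENNReal.toReal_ofNat, Real.rpow_two] at h
  rw [h, tsum_eq_sum (s := s) fun n hn => by simp [hs n hn], ← nsmul_eq_mul]
  refine Finset.sum_le_card_nsmul _ _ _ fun n _ => ?_
  have := hB n
  gcongr

theorem norm_sq_laplacian_bump_le {N : ℕ} (hN : 1 ≤ N) :
    ‖laplacian (bump N)‖ ^ 2 ≤ (2 * N + 1) * (14 * (N : ℝ) ^ 2) ^ 2 := by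
  have he : ∀ n, (laplacian (bump N) : ℤ → ℂ) n
      = ((bumpFun N (n + 1) + bumpFun N (n - 1) - 2 * bumpFun N n : ℝ) : ℂ) := fun n => by
    rw [laplacian_apply, bump_apply, bump_apply, bump_apply]; push_cast; ring
  have := norm_sq_le_of_support (x := laplacian (bump N)) (s := Finset.Icc (-(N : ℤ)) N)
    (B := 14 * (N : ℝ) ^ 2) (fun n hn => ?_) fun n => ?_
  · rw [card_Icc_neg] at this
    exact_mod_cast this
  · rw [Finset.mem_Icc] at hn
    rw [he, bumpFun_of_le_abs (n := n), bumpFun_of_le_abs (n := n + 1),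
      bumpFun_of_le_abs (n := n - 1)]
    · simp
    all_goals rw [le_abs]; omega
  · rw [he, Complex.norm_real]
    exact abs_bumpFun_laplacian_le hN n

/-- The middle half |n| ≤ M has 2M + 1 points, each contributing at least (4M² − M²)⁴ = 81M⁸. -/
theorem le_norm_sq_bump (M : ℕ) : 162 * (M : ℝ) ^ 9 ≤ ‖bump (2 * M)‖ ^ 2 := by
  have h := lp.sum_rpow_le_norm_rpow (p := 2) (by norm_num) (bump (2 * M))
    (Finset.Icc (-(M : ℤ)) M)
  simp only [ENNReal.toReal_ofNat, Real.rpow_two] at h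
  refine le_trans ?_ h
  have h1 := Finset.card_nsmul_le_sum (Finset.Icc (-(M : ℤ)) M)
    (fun n => ‖(bump (2 * M) : ℤ → ℂ) n‖ ^ 2) ((9 * (M : ℝ) ^ 4) ^ 2) fun n hn => by
      rw [Finset.mem_Icc] at hn
      have hn1 : |n| ≤ (M : ℤ) := abs_le.2 hn
      have hn2 : (n : ℝ) ^ 2 ≤ (M : ℝ) ^ 2 := by
        have : |(n : ℝ)| ≤ M := by exact_mod_cast hn1
        exact sq_le_sq' (by linarith [(abs_le.1 this).1]) (abs_le.1 this).2
      rw [bump_apply, Complex.norm_real, Real.norm_of_nonneg (bumpFun_nonneg _ n),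
        bumpFun_of_abs_le (by push_cast; omega)]
      push_cast
      have h3 : 3 * (M : ℝ) ^ 2 ≤ (2 * (M : ℝ)) ^ 2 - (n : ℝ) ^ 2 := by nlinarith
      have h4 : 9 * (M : ℝ) ^ 4 ≤ ((2 * (M : ℝ)) ^ 2 - (n : ℝ) ^ 2) ^ 2 := by
        calc 9 * (M : ℝ) ^ 4 = (3 * (M : ℝ) ^ 2) ^ 2 := by ring
          _ ≤ _ := by gcongr
      gcongr
  refine le_trans ?_ h1
  rw [card_Icc_neg, nsmul_eq_mul]
  push_cast
  have : 0 ≤ (M : ℝ) ^ 8 := by positivity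
  nlinarith

/-- A bump x of width 2M is tested at a time proportional to M⁴. Its overlap with its own evolution
stays above a multiple of M⁹, while ℓ¹–ℓ^∞ duality and the decay bound it by a multiple of
M^{10−4α}; letting M → ∞ excludes α > 1/4. -/
theorem le_of_decayEstimate {α : ℝ} (h : DecayEstimate α) : α ≤ 1 / 4 := by
  obtain ⟨C, hC⟩ := h
  by_contra! hα
  have key : ∀ M : ℕ, 1 ≤ M →
      80 ≤ C * (1000 : ℝ) ^ α * 6400 * (M : ℝ) ^ (1 - 4 * α) := fun M hM => by
    have hM' : (1 : ℝ) ≤ M := by exact_mod_cast hM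
    have hM0 : (0 : ℝ) < M := by linarith
    -- The denominator makes the drift ‖Δx‖²t at most 15.68·M⁹, well below the 162·M⁹ available in
    -- ‖x‖².
    set t : ℝ := (M : ℝ) ^ 4 / 1000 with ht
    have ht0 : 0 < t := by positivity
    set x := bump (2 * M) with hx
    have h1 : 162 * (M : ℝ) ^ 9 ≤ ‖x‖ ^ 2 := le_norm_sq_bump M
    have h2 : ‖laplacian x‖ ^ 2 ≤ 5 * M * (56 * (M : ℝ) ^ 2) ^ 2 := by
      refine (norm_sq_laplacian_bump_le (N := 2 * M) (by omega)).trans ?_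
      push_cast
      have : 14 * (2 * (M : ℝ)) ^ 2 = 56 * (M : ℝ) ^ 2 := by ring
      rw [this]
      gcongr
      linarith
    have h3 : ellNorm 1 (x : ℤ → ℂ) ≤ ENNReal.ofReal (80 * (M : ℝ) ^ 5) := by
      refine (ellNorm_one_bump_le (2 * M)).trans (ENNReal.ofReal_le_ofReal ?_)
      push_cast
      have : 0 ≤ (M : ℝ) ^ 4 := by positivity
      nlinarith
    have h4 : ‖inner ℂ x (freeGroup t x)‖ₑ
        ≤ ENNReal.ofReal (80 * (M : ℝ) ^ 5 * (C * t ^ (-α) * (80 * (M : ℝ) ^ 5))) := by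
      refine (enorm_inner_le _ _).trans ?_
      rw [← ellNorm_top, ENNReal.ofReal_mul (by positivity)]
      refine mul_le_mul' h3 ((hC t ht0.ne' x (memℓp_one_bump _)).trans ?_)
      rw [ENNReal.ofReal_mul (by positivity), ENNReal.ofReal_mul (NNReal.coe_nonneg C), abs_of_pos ht0,
        ENNReal.ofReal_coe_nnreal]
      gcongr
    rw [← ofReal_norm, ENNReal.ofReal_le_ofReal_iff (by positivity)] at h4
    have h5 := norm_inner_freeGroup_sub_le t x
    have h6 : ‖inner ℂ x x‖ = ‖x‖ ^ 2 := by
      rw [inner_self_eq_norm_sq_to_K, norm_pow]; simp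
    have h7 : ‖x‖ ^ 2 ≤ ‖inner ℂ x (freeGroup t x)‖ + ‖laplacian x‖ ^ 2 * |t| := by
      rw [← h6]
      have := norm_sub_norm_le (inner ℂ x x) (inner ℂ x (freeGroup t x))
      rw [norm_sub_rev] at this
      linarith
    rw [abs_of_pos ht0] at h7
    have h8 : ‖laplacian x‖ ^ 2 * t ≤ 82 * (M : ℝ) ^ 9 := by
      calc ‖laplacian x‖ ^ 2 * t ≤ 5 * M * (56 * (M : ℝ) ^ 2) ^ 2 * ((M : ℝ) ^ 4 / 1000) := by
            gcongr
        _ = 15.68 * (M : ℝ) ^ 9 := by ring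
        _ ≤ _ := by gcongr; norm_num
    have h9 : 80 * (M : ℝ) ^ 9 ≤ 80 * (M : ℝ) ^ 5 * (C * t ^ (-α) * (80 * (M : ℝ) ^ 5)) := by
      linarith
    have h10 : t ^ (-α) * (M : ℝ) = (1000 : ℝ) ^ α * (M : ℝ) ^ (1 - 4 * α) := by
      rw [ht, Real.div_rpow (by positivity) (by norm_num), ← Real.rpow_natCast,
        ← Real.rpow_mul hM0.le, Real.rpow_neg (by norm_num : (0 : ℝ) ≤ 1000), div_inv_eq_mul,
        mul_right_comm, ← Real.rpow_add_one hM0.ne', mul_comm]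
      congr 2
      push_cast
      ring
    have h11 : (80 : ℝ) * (M : ℝ) ^ 9
        ≤ (C * (1000 : ℝ) ^ α * 6400 * (M : ℝ) ^ (1 - 4 * α)) * (M : ℝ) ^ 9 := by
      calc (80 : ℝ) * (M : ℝ) ^ 9 ≤ _ := h9
        _ = C * 6400 * (t ^ (-α) * (M : ℝ)) * (M : ℝ) ^ 9 := by ring
        _ = _ := by rw [h10]; ring
    exact le_of_mul_le_mul_right h11 (by positivity)
  have hlim : Filter.Tendsto (fun M : ℕ => C * (1000 : ℝ) ^ α * 6400 * (M : ℝ) ^ (1 - 4 * α))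
      Filter.atTop (nhds (C * (1000 : ℝ) ^ α * 6400 * 0)) := by
    refine Filter.Tendsto.const_mul _ ?_
    have := (tendsto_rpow_neg_atTop (y := 4 * α - 1) (by linarith)).comp
      (tendsto_natCast_atTop_atTop (R := ℝ))
    refine this.congr fun M => ?_
    simp
  rw [mul_zero] at hlim
  have := ge_of_tendsto hlim (Filter.eventually_atTop.2 ⟨1, key⟩)
  norm_num at this

theorem isGreatest_decayEstimate : IsGreatest {α : ℝ | DecayEstimate α} (1 / 4) :=
  ⟨decayEstimate_one_fourth, fun _ h => le_of_decayEstimate h⟩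

/-! ### Fractional integration -/

theorem lintegral_comp_abs {f : ℝ → ℝ≥0∞} (hf : Measurable f) :
    ∫⁻ x, f |x| = 2 * ∫⁻ x in Set.Ioi 0, f x := by
  have h1 : ∫⁻ x in Set.Ioi 0, f |x| = ∫⁻ x in Set.Ioi 0, f x :=
    setLIntegral_congr_fun measurableSet_Ioi fun x hx => by
      simp only [abs_of_pos (Set.mem_Ioi.1 hx)]
  have h2 : ∫⁻ x in Set.Iio 0, f |x| = ∫⁻ x in Set.Ioi 0, f |x| := by
    have := (Measure.measurePreserving_neg (volume : Measure ℝ)).setLIntegral_comp_preimage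
      (s := Set.Ioi 0) measurableSet_Ioi (hf.comp measurable_norm)
    simpa [Function.comp_def] using this
  rw [← lintegral_add_compl _ (measurableSet_Ioi (a := (0 : ℝ))), Set.compl_Ioi,
    setLIntegral_congr Iio_ae_eq_Iic.symm, h2, h1, two_mul]

/-- The kernel `|t|^{-1/4}`. -/
def rieszKernel (t : ℝ) : ℝ≥0∞ := ENNReal.ofReal |t| ^ (-(1 / 4) : ℝ)

theorem measurable_rieszKernel : Measurable rieszKernel := by
  unfold rieszKernel; fun_prop

theorem rieszKernel_neg (t : ℝ) : rieszKernel (-t) = rieszKernel t := by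
  simp [rieszKernel]

theorem rieszKernel_of_ne {t : ℝ} (ht : t ≠ 0) :
    rieszKernel t = ENNReal.ofReal (|t| ^ (-(1 / 4) : ℝ)) := by
  rw [rieszKernel, ENNReal.ofReal_rpow_of_pos (abs_pos.2 ht)]

theorem lintegral_rieszKernel_near_le {R : ℝ} (hR : 0 < R) :
    ∫⁻ x, {x : ℝ | |x| ≤ R}.indicator rieszKernel x ≤ ENNReal.ofReal (3 * R ^ (3 / 4 : ℝ)) := by
  have h1 : ∀ x : ℝ, {x : ℝ | |x| ≤ R}.indicator rieszKernel x
      = (Set.Iic R).indicator (fun x => ENNReal.ofReal x ^ (-(1 / 4) : ℝ)) |x| := fun x => by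
    by_cases h : |x| ≤ R <;> simp [Set.indicator, h, rieszKernel]
  simp_rw [h1]
  rw [lintegral_comp_abs (Measurable.indicator (by fun_prop) measurableSet_Iic),
    lintegral_indicator measurableSet_Iic, Measure.restrict_restrict measurableSet_Iic,
    Set.Iic_inter_Ioi]
  have hint : IntervalIntegrable (fun x : ℝ => x ^ (-(1 / 4) : ℝ)) volume 0 R :=
    intervalIntegral.intervalIntegrable_rpow' (by norm_num)
  have h2 : ∫⁻ x in Set.Ioc 0 R, ENNReal.ofReal x ^ (-(1 / 4) : ℝ)
      = ENNReal.ofReal (∫ x in (0 : ℝ)..R, x ^ (-(1 / 4) : ℝ)) := by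
    rw [intervalIntegral.integral_of_le hR.le,
      ofReal_integral_eq_lintegral_ofReal]
    · refine setLIntegral_congr_fun measurableSet_Ioc fun x hx => ?_
      simp only [ENNReal.ofReal_rpow_of_pos hx.1]
    · exact ((intervalIntegrable_iff_integrableOn_Ioc_of_le hR.le).1 hint)
    · exact (ae_restrict_iff' measurableSet_Ioc).2
        (Filter.Eventually.of_forall fun x hx => Real.rpow_nonneg hx.1.le _)
  rw [h2, integral_rpow (Or.inl (by norm_num)), show (2 : ℝ≥0∞) = ENNReal.ofReal 2 by norm_num,
    ← ENNReal.ofReal_mul (by norm_num)]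
  refine ENNReal.ofReal_le_ofReal ?_
  norm_num
  have : 0 ≤ R ^ (3 / 4 : ℝ) := by positivity
  linarith

/-- The exponent 8 is conjugate to 8/7; the eighth power of the kernel is |x|^{-2}, integrable at
infinity. -/
theorem lintegral_rieszKernel_far_le {R : ℝ} (hR : 0 < R) :
    ∫⁻ x, ({x : ℝ | R < |x|}.indicator rieszKernel x) ^ (8 : ℝ) ≤ ENNReal.ofReal (2 * R⁻¹) := by
  have h1 : ∀ x : ℝ, ({x : ℝ | R < |x|}.indicator rieszKernel x) ^ (8 : ℝ)
      = (Set.Ioi R).indicator (fun x => ENNReal.ofReal x ^ (-2 : ℝ)) |x| := fun x => by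
    by_cases h : R < |x|
    · rw [Set.indicator_of_mem (by exact h), Set.indicator_of_mem (by exact h), rieszKernel,
        ← ENNReal.rpow_mul]
      norm_num
    · simp [Set.indicator, h]
  simp_rw [h1]
  rw [lintegral_comp_abs (Measurable.indicator (by fun_prop) measurableSet_Ioi),
    lintegral_indicator measurableSet_Ioi, Measure.restrict_restrict measurableSet_Ioi,
    Set.Ioi_inter_Ioi, max_eq_left hR.le]
  have h2 : ∫⁻ x in Set.Ioi R, ENNReal.ofReal x ^ (-2 : ℝ)
      = ENNReal.ofReal (∫ x in Set.Ioi R, x ^ (-2 : ℝ)) := by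
    rw [ofReal_integral_eq_lintegral_ofReal]
    · refine setLIntegral_congr_fun measurableSet_Ioi fun x hx => ?_
      simp only [ENNReal.ofReal_rpow_of_pos (hR.trans hx)]
    · exact integrableOn_Ioi_rpow_of_lt (by norm_num) hR
    · exact (ae_restrict_iff' measurableSet_Ioi).2
        (Filter.Eventually.of_forall fun x hx => Real.rpow_nonneg (hR.trans hx).le _)
  rw [h2, integral_Ioi_rpow_of_lt (by norm_num) hR, show (2 : ℝ≥0∞) = ENNReal.ofReal 2 by norm_num,
    ← ENNReal.ofReal_mul (by norm_num)]
  refine ENNReal.ofReal_le_ofReal (le_of_eq ?_)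
  rw [show (-2 : ℝ) + 1 = -1 by norm_num, Real.rpow_neg_one]
  ring

/-- The norm of `L^{8/7}(ℝ)`. -/
def dualNorm (g : ℝ → ℝ≥0∞) : ℝ≥0∞ := (∫⁻ t, g t ^ (8 / 7 : ℝ)) ^ (7 / 8 : ℝ)

theorem dualNorm_mono {f g : ℝ → ℝ≥0∞} (h : ∀ t, f t ≤ g t) : dualNorm f ≤ dualNorm g := by
  unfold dualNorm
  gcongr with t
  exact h t

theorem dualNorm_const_mul (c : ℝ≥0∞) {g : ℝ → ℝ≥0∞} (hg : Measurable g) :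
    dualNorm (fun t => c * g t) = c * dualNorm g := by
  unfold dualNorm
  simp_rw [ENNReal.mul_rpow_of_nonneg _ _ (by norm_num : (0 : ℝ) ≤ 8 / 7)]
  rw [lintegral_const_mul _ (by fun_prop), ENNReal.mul_rpow_of_nonneg _ _ (by norm_num),
    ← ENNReal.rpow_mul]
  norm_num

theorem dualNorm_add_le {f g : ℝ → ℝ≥0∞} (hf : Measurable f) (hg : Measurable g) :
    dualNorm (fun t => f t + g t) ≤ dualNorm f + dualNorm g := by
  have := ENNReal.lintegral_Lp_add_le (μ := volume) (p := 8 / 7) hf.aemeasurable hg.aemeasurable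
    (by norm_num)
  rw [show (1 / (8 / 7) : ℝ) = 7 / 8 by norm_num] at this
  exact this

/-- The integral is split at |t − s| = R. On the near part g(s) ≤ g(t) is used and the kernel
integrates to at most 3R^{3/4}; the far part is estimated by Hölder with exponents 8 and 8/7. With R
= g(t)^{-8/7} both are multiples of g(t)^{1/7}, with constants 3 and 2. The restriction to a
sublevel set takes the place of a maximal function. -/
theorem lintegral_rieszKernel_sublevel_le {g : ℝ → ℝ≥0∞} (hg : Measurable g)
    (h1 : ∫⁻ t, g t ^ (8 / 7 : ℝ) ≤ 1) {t : ℝ} (h0 : g t ≠ 0) (ht : g t ≠ ∞) :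
    ∫⁻ s, {s | g s ≤ g t}.indicator (fun s => rieszKernel (t - s) * g s) s
      ≤ 5 * g t ^ (1 / 7 : ℝ) := by
  set y := (g t).toReal with hy
  have hy0 : 0 < y := ENNReal.toReal_pos h0 ht
  have hgt : g t = ENNReal.ofReal y := (ENNReal.ofReal_toReal ht).symm
  set R := y ^ (-(8 / 7) : ℝ) with hR
  have hR0 : 0 < R := by positivity
  have hmeas : Measurable fun s => rieszKernel (t - s) :=
    measurable_rieszKernel.comp (by fun_prop)
  have hsplit : ∀ s, {s | g s ≤ g t}.indicator (fun s => rieszKernel (t - s) * g s) s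
      ≤ g t * {x : ℝ | |x| ≤ R}.indicator rieszKernel (t - s)
        + ({x : ℝ | R < |x|}.indicator rieszKernel (t - s)) * g s := fun s => by
    by_cases hs : g s ≤ g t
    · rw [Set.indicator_of_mem (by exact hs)]
      by_cases hR' : R < |t - s|
      · rw [Set.indicator_of_mem (s := {x : ℝ | R < |x|}) (by exact hR')]
        exact le_add_self
      · rw [Set.indicator_of_mem (s := {x : ℝ | |x| ≤ R}) (by
          change |t - s| ≤ R; exact not_lt.1 hR'), mul_comm]
        exact le_add_right (by gcongr)
    · rw [Set.indicator_of_notMem (by exact hs)]; exact zero_le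
  have htrans : ∀ f : ℝ → ℝ≥0∞, ∫⁻ s, f (t - s) = ∫⁻ s, f s := fun f =>
    lintegral_sub_left_eq_self f t
  have hnear : ∫⁻ s, {x : ℝ | |x| ≤ R}.indicator rieszKernel (t - s)
      ≤ ENNReal.ofReal (3 * R ^ (3 / 4 : ℝ)) := by
    rw [htrans]
    exact lintegral_rieszKernel_near_le (by positivity)
  have hm1 : Measurable ({x : ℝ | R < |x|}.indicator rieszKernel) :=
    measurable_rieszKernel.indicator (measurableSet_lt measurable_const measurable_norm)
  have hm2 : Measurable ({x : ℝ | |x| ≤ R}.indicator rieszKernel) :=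
    measurable_rieszKernel.indicator (measurableSet_le measurable_norm measurable_const)
  have hfar : ∫⁻ s, ({x : ℝ | R < |x|}.indicator rieszKernel (t - s)) * g s
      ≤ ENNReal.ofReal ((2 * R⁻¹) ^ (1 / 8 : ℝ)) := by
    refine (ENNReal.lintegral_mul_le_Lp_mul_Lq volume (p := 8) (q := 8 / 7)
      (Real.holderConjugate_iff.2 (by norm_num)) (f := fun s =>
        {x : ℝ | R < |x|}.indicator rieszKernel (t - s)) (g := g) ?_ hg.aemeasurable).trans ?_
    · exact (hm1.comp (by fun_prop)).aemeasurable
    · rw [htrans (fun s => ({x : ℝ | R < |x|}.indicator rieszKernel s) ^ (8 : ℝ)),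
        ← ENNReal.ofReal_rpow_of_pos (by positivity)]
      calc _ ≤ ENNReal.ofReal (2 * R⁻¹) ^ (1 / 8 : ℝ) * 1 ^ (1 / (8 / 7) : ℝ) := by
            gcongr
            exact lintegral_rieszKernel_far_le hR0
        _ = _ := by simp
  have hp1 : R ^ (3 / 4 : ℝ) = y ^ (-(6 / 7) : ℝ) := by
    rw [hR, ← Real.rpow_mul hy0.le]; norm_num
  have hp2 : (2 * R⁻¹) ^ (1 / 8 : ℝ) ≤ 2 * y ^ (1 / 7 : ℝ) := by
    rw [Real.mul_rpow (by norm_num) (by positivity), hR, ← Real.rpow_neg hy0.le,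
      ← Real.rpow_mul hy0.le, show (-(-(8 / 7)) * (1 / 8) : ℝ) = 1 / 7 by norm_num]
    gcongr
    exact Real.rpow_le_self_of_one_le (by norm_num) (by norm_num)
  have hp3 : y * y ^ (-(6 / 7) : ℝ) = y ^ (1 / 7 : ℝ) := by
    nth_rewrite 1 [← Real.rpow_one y]
    rw [← Real.rpow_add hy0]; norm_num
  calc ∫⁻ s, {s | g s ≤ g t}.indicator (fun s => rieszKernel (t - s) * g s) s
      ≤ ∫⁻ s, (g t * {x : ℝ | |x| ≤ R}.indicator rieszKernel (t - s)
        + ({x : ℝ | R < |x|}.indicator rieszKernel (t - s)) * g s) := lintegral_mono hsplit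
    _ = g t * (∫⁻ s, {x : ℝ | |x| ≤ R}.indicator rieszKernel (t - s))
        + ∫⁻ s, ({x : ℝ | R < |x|}.indicator rieszKernel (t - s)) * g s := by
      have hm3 : Measurable fun s => {x : ℝ | |x| ≤ R}.indicator rieszKernel (t - s) :=
        hm2.comp (by fun_prop)
      rw [lintegral_add_left (hm3.const_mul _), lintegral_const_mul _ hm3]
    _ ≤ ENNReal.ofReal y * ENNReal.ofReal (3 * y ^ (-(6 / 7) : ℝ))
        + ENNReal.ofReal (2 * y ^ (1 / 7 : ℝ)) := by
      rw [← hgt, ← hp1]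
      exact add_le_add (mul_le_mul_right hnear _) (hfar.trans (ENNReal.ofReal_le_ofReal hp2))
    _ = ENNReal.ofReal (5 * y ^ (1 / 7 : ℝ)) := by
      rw [← ENNReal.ofReal_mul hy0.le, ← ENNReal.ofReal_add (by positivity) (by positivity)]
      congr 1
      rw [mul_left_comm, hp3]
      ring
    _ = 5 * g t ^ (1 / 7 : ℝ) := by
      rw [hgt, ENNReal.ofReal_mul (by norm_num), ENNReal.ofReal_rpow_of_pos hy0]
      norm_num

/-- The potential `∫ |t - s|^{-1/4} g(s) ds`. -/
def rieszPotential (g : ℝ → ℝ≥0∞) (t : ℝ) : ℝ≥0∞ := ∫⁻ s, rieszKernel (t - s) * g s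

theorem measurable_rieszKernel_sub : Measurable fun p : ℝ × ℝ => rieszKernel (p.1 - p.2) :=
  measurable_rieszKernel.comp (by fun_prop)

theorem measurable_rieszPotential {g : ℝ → ℝ≥0∞} (hg : Measurable g) :
    Measurable (rieszPotential g) :=
  Measurable.lintegral_prod_right'
    (f := fun p : ℝ × ℝ => rieszKernel (p.1 - p.2) * g p.2)
    (measurable_rieszKernel_sub.mul (hg.comp measurable_snd))

/-- The kernel is even, so the double integral is at most twice its part over {g(s) ≤ g(t)}. There
the inner integral, times g(t), is at most 5g(t)^{8/7}. -/
theorem lintegral_mul_rieszPotential_self_le {g : ℝ → ℝ≥0∞} (hg : Measurable g)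
    (h1 : ∫⁻ t, g t ^ (8 / 7 : ℝ) ≤ 1) : ∫⁻ t, g t * rieszPotential g t ≤ 10 := by
  set H : ℝ → ℝ → ℝ≥0∞ := fun t s =>
    g t * {s | g s ≤ g t}.indicator (fun s => rieszKernel (t - s) * g s) s with hH
  have hHm : Measurable (Function.uncurry H) := by
    have hset : MeasurableSet {p : ℝ × ℝ | g p.2 ≤ g p.1} :=
      measurableSet_le (hg.comp measurable_snd) (hg.comp measurable_fst)
    have : Function.uncurry H = fun p : ℝ × ℝ => g p.1 *
        {p : ℝ × ℝ | g p.2 ≤ g p.1}.indicator (fun p => rieszKernel (p.1 - p.2) * g p.2) p := by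
      ext ⟨t, s⟩
      rfl
    rw [this]
    exact (hg.comp measurable_fst).mul
      ((measurable_rieszKernel_sub.mul (hg.comp measurable_snd)).indicator hset)
  have hle : ∀ t s, g t * (rieszKernel (t - s) * g s) ≤ H t s + H s t := fun t s => by
    rcases le_total (g s) (g t) with h | h
    · simp only [hH]
      rw [Set.indicator_of_mem (s := {s | g s ≤ g t}) (by exact h)]
      exact le_self_add
    · simp only [hH]
      rw [Set.indicator_of_mem (s := {s' | g s' ≤ g s}) (by exact h), ← rieszKernel_neg (s - t),
        neg_sub]
      refine le_add_left (le_of_eq ?_)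
      ring
  have hfin : ∀ᵐ t, g t ^ (8 / 7 : ℝ) < ∞ :=
    ae_lt_top (by fun_prop) (h1.trans_lt ENNReal.one_lt_top).ne
  have hinner : ∀ᵐ t, ∫⁻ s, H t s ≤ 5 * g t ^ (8 / 7 : ℝ) := by
    filter_upwards [hfin] with t ht
    have hm : Measurable ({s | g s ≤ g t}.indicator (fun s => rieszKernel (t - s) * g s)) :=
      Measurable.indicator ((measurable_rieszKernel.comp (by fun_prop)).mul hg)
        (measurableSet_le hg measurable_const)
    simp only [hH]
    rw [lintegral_const_mul _ hm]
    rcases eq_or_ne (g t) 0 with h0 | h0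
    · simp [h0]
    have ht' : g t ≠ ∞ := fun h => by simp [h] at ht
    refine (mul_le_mul_right (lintegral_rieszKernel_sublevel_le hg h1 h0 ht') _).trans
      (le_of_eq ?_)
    rw [mul_left_comm]
    congr 1
    nth_rewrite 1 [← ENNReal.rpow_one (g t)]
    rw [← ENNReal.rpow_add _ _ h0 ht']
    norm_num
  have hdouble : ∫⁻ t, ∫⁻ s, H t s ≤ 5 := by
    refine (lintegral_mono_ae hinner).trans ?_
    rw [lintegral_const_mul _ (by fun_prop)]
    exact (mul_le_mul_right h1 _).trans (by simp)
  calc ∫⁻ t, g t * rieszPotential g t = ∫⁻ t, ∫⁻ s, g t * (rieszKernel (t - s) * g s) := by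
        refine lintegral_congr fun t => ?_
        rw [rieszPotential, lintegral_const_mul]
        exact (measurable_rieszKernel.comp (by fun_prop)).mul hg
    _ ≤ ∫⁻ t, ∫⁻ s, (H t s + H s t) := lintegral_mono fun t => lintegral_mono fun s => hle t s
    _ = (∫⁻ t, ∫⁻ s, H t s) + ∫⁻ t, ∫⁻ s, H s t := by
        have : ∀ t, ∫⁻ s, (H t s + H s t) = (∫⁻ s, H t s) + ∫⁻ s, H s t := fun t =>
          lintegral_add_left (hHm.comp measurable_prodMk_left) _
        simp_rw [this]
        exact lintegral_add_left hHm.lintegral_prod_right' _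
    _ = (∫⁻ t, ∫⁻ s, H t s) + ∫⁻ t, ∫⁻ s, H t s := by
        rw [lintegral_lintegral_swap hHm.aemeasurable]
    _ ≤ 5 + 5 := add_le_add hdouble hdouble
    _ = 10 := by norm_num

theorem lintegral_rpow_le_one_of_dualNorm_le_one {g : ℝ → ℝ≥0∞} (h : dualNorm g ≤ 1) :
    ∫⁻ t, g t ^ (8 / 7 : ℝ) ≤ 1 := by
  have := ENNReal.rpow_le_rpow h (by norm_num : (0 : ℝ) ≤ 8 / 7)
  rw [dualNorm, ← ENNReal.rpow_mul] at this
  norm_num at this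
  exact this

theorem rieszPotential_const_mul (c : ℝ≥0∞) {g : ℝ → ℝ≥0∞} (hg : Measurable g) (t : ℝ) :
    rieszPotential (fun s => c * g s) t = c * rieszPotential g t := by
  rw [rieszPotential, rieszPotential, ← lintegral_const_mul]
  · simp_rw [mul_left_comm]
  · exact (measurable_rieszKernel.comp (by fun_prop)).mul hg

theorem rieszPotential_mono {f g : ℝ → ℝ≥0∞} (h : ∀ t, f t ≤ g t) (t : ℝ) :
    rieszPotential f t ≤ rieszPotential g t :=
  lintegral_mono fun s => by have := h s; gcongr

theorem ae_eq_zero_of_dualNorm_eq_zero {g : ℝ → ℝ≥0∞} (hg : Measurable g) (h : dualNorm g = 0) :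
    ∀ᵐ t, g t = 0 := by
  rw [dualNorm, ENNReal.rpow_eq_zero_iff_of_pos (by norm_num), lintegral_eq_zero_iff (by fun_prop)]
    at h
  filter_upwards [h] with t ht
  exact (ENNReal.rpow_eq_zero_iff_of_pos (by norm_num)).1 ht

/-- The mean f of h and g again has norm at most 1 by Minkowski, and h, g ≤ 2f, so the diagonal
bound yields 4 · 10. -/
theorem lintegral_mul_rieszPotential_le_of_le_one {h g : ℝ → ℝ≥0∞} (hh : Measurable h)
    (hg : Measurable g) (h1 : dualNorm h ≤ 1) (g1 : dualNorm g ≤ 1) :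
    ∫⁻ t, h t * rieszPotential g t ≤ 40 := by
  set f : ℝ → ℝ≥0∞ := fun t => 2⁻¹ * (h t + g t) with hf
  have hfm : Measurable f := by fun_prop
  have hf1 : dualNorm f ≤ 1 := by
    rw [hf, dualNorm_const_mul _ (by fun_prop)]
    refine (mul_le_mul_right ((dualNorm_add_le hh hg).trans (add_le_add h1 g1)) _).trans ?_
    rw [one_add_one_eq_two, ENNReal.inv_mul_cancel (by norm_num) (by norm_num)]
  have key := lintegral_mul_rieszPotential_self_le hfm
    (lintegral_rpow_le_one_of_dualNorm_le_one hf1)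
  have hpt : ∀ t, h t * rieszPotential g t ≤ 4 * (f t * rieszPotential f t) := fun t => by
    have h2 : ∀ t, h t ≤ 2 * f t := fun t => by
      simp only [hf]
      rw [← mul_assoc, ENNReal.mul_inv_cancel (by norm_num) (by norm_num), one_mul]
      exact le_self_add
    have h3 : ∀ t, g t ≤ 2 * f t := fun t => by
      simp only [hf]
      rw [← mul_assoc, ENNReal.mul_inv_cancel (by norm_num) (by norm_num), one_mul]
      exact le_add_self
    have h4 : rieszPotential g t ≤ 2 * rieszPotential f t := by
      rw [← rieszPotential_const_mul 2 hfm]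
      exact rieszPotential_mono h3 t
    refine (mul_le_mul' (h2 t) h4).trans (le_of_eq ?_)
    ring
  refine (lintegral_mono hpt).trans ?_
  have hm := measurable_rieszPotential hfm
  rw [lintegral_const_mul _ (by fun_prop)]
  refine (mul_le_mul_right key _).trans ?_
  norm_num

/-- The Hardy–Littlewood–Sobolev inequality for the kernel `|t|^{-1/4}` on `L^{8/7}(ℝ)`. -/
theorem lintegral_mul_rieszPotential_le {h g : ℝ → ℝ≥0∞} (hh : Measurable h) (hg : Measurable g) :
    ∫⁻ t, h t * rieszPotential g t ≤ 40 * dualNorm h * dualNorm g := by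
  rcases eq_or_ne (dualNorm h) 0 with h0 | h0
  · have := ae_eq_zero_of_dualNorm_eq_zero hh h0
    rw [lintegral_congr_ae (g := fun _ => 0) (by filter_upwards [this] with t ht; simp [ht])]
    simp
  rcases eq_or_ne (dualNorm g) 0 with g0 | g0
  · have := ae_eq_zero_of_dualNorm_eq_zero hg g0
    have h2 : ∀ t, rieszPotential g t = 0 := fun t => by
      rw [rieszPotential,
        lintegral_congr_ae (g := fun _ => 0) (by filter_upwards [this] with t ht; simp [ht])]
      simp
    simp [h2]
  rcases eq_or_ne (dualNorm h) ∞ with ht | ht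
  · rw [ht, ENNReal.mul_top (by norm_num), ENNReal.top_mul g0]; exact le_top
  rcases eq_or_ne (dualNorm g) ∞ with gt | gt
  · rw [gt, ENNReal.mul_top (mul_ne_zero (by norm_num) h0)]; exact le_top
  set a := dualNorm h with ha
  set b := dualNorm g with hb
  have key := lintegral_mul_rieszPotential_le_of_le_one (h := fun t => a⁻¹ * h t)
    (g := fun t => b⁻¹ * g t) (by fun_prop) (by fun_prop)
    (by rw [dualNorm_const_mul _ hh, ENNReal.inv_mul_cancel h0 ht])
    (by rw [dualNorm_const_mul _ hg, ENNReal.inv_mul_cancel g0 gt])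
  have h2 : ∀ t, h t * rieszPotential g t
      = a * b * (a⁻¹ * h t * rieszPotential (fun t => b⁻¹ * g t) t) := fun t => by
    rw [rieszPotential_const_mul _ hg]
    calc h t * rieszPotential g t = (a * a⁻¹) * (b * b⁻¹) * (h t * rieszPotential g t) := by
          rw [ENNReal.mul_inv_cancel h0 ht, ENNReal.mul_inv_cancel g0 gt]; simp
      _ = _ := by ring
  simp_rw [h2]
  rw [lintegral_const_mul]
  · refine (mul_le_mul_right key _).trans (le_of_eq ?_)
    ring
  · exact (hh.const_mul _).mul (measurable_rieszPotential (hg.const_mul _))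

/-! ### Duality between `L^{8/7}` and `L^8` -/

/-- Bounded, compactly supported measurable weights. -/
structure IsTest (h : ℝ → ℝ≥0∞) : Prop where
  measurable : Measurable h
  le_indicator : ∃ R : ℝ≥0, ∀ t, h t ≤ (Set.Icc (-(R : ℝ)) R).indicator (fun _ => (R : ℝ≥0∞)) t

/-- Truncation in height and support. -/
def trunc (N : ℕ) (g : ℝ → ℝ≥0∞) (t : ℝ) : ℝ≥0∞ :=
  (Set.Icc (-(N : ℝ)) N).indicator (fun t => min (g t) N) t

theorem measurable_trunc (N : ℕ) {g : ℝ → ℝ≥0∞} (hg : Measurable g) : Measurable (trunc N g) :=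
  (hg.min measurable_const).indicator measurableSet_Icc

theorem trunc_le (N : ℕ) (g : ℝ → ℝ≥0∞) (t : ℝ) : trunc N g t ≤ g t :=
  Set.indicator_apply_le' (fun _ => min_le_left _ _) fun _ => zero_le

theorem monotone_trunc (g : ℝ → ℝ≥0∞) : Monotone fun N => trunc N g := by
  intro M N hMN t
  have hMN' : (M : ℝ) ≤ N := by exact_mod_cast hMN
  unfold trunc
  refine Set.indicator_le' (fun t ht => ?_) (fun _ _ => zero_le) t
  rw [Set.indicator_of_mem (Set.Icc_subset_Icc (by linarith) hMN' ht)]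
  exact min_le_min_left _ (by exact_mod_cast hMN)

theorem iSup_trunc (g : ℝ → ℝ≥0∞) (t : ℝ) : ⨆ N, trunc N g t = g t := by
  refine le_antisymm (iSup_le fun N => trunc_le N g t) (le_of_forall_lt fun c hc => ?_)
  obtain ⟨M, hM⟩ := exists_nat_ge |t|
  obtain ⟨K, hK⟩ := ENNReal.exists_nat_gt hc.ne_top
  refine lt_of_lt_of_le ?_ (le_iSup (fun N => trunc N g t) (max M K))
  have hM' : |t| ≤ ((max M K : ℕ) : ℝ) := hM.trans (by exact_mod_cast le_max_left M K)
  simp only [trunc]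
  rw [Set.indicator_of_mem (by exact abs_le.1 hM')]
  exact lt_min hc (hK.trans_le (by exact_mod_cast le_max_right M K))

/-- Testing against the seventh power of a truncation of g gives S ≤ K·S^{7/8} for S the integral of
the eighth power of the truncation. Truncation makes S finite, so that S^{7/8} can be cancelled;
monotone convergence removes it. -/
theorem lintegral_rpow_eight_le_of_test {g : ℝ → ℝ≥0∞} (hg : Measurable g) {K : ℝ≥0∞}
    (h : ∀ w : ℝ → ℝ≥0∞, IsTest w → ∫⁻ t, w t * g t ≤ K * dualNorm w) :
    ∫⁻ t, g t ^ (8 : ℝ) ≤ K ^ (8 : ℝ) := by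
  have hN : ∀ N : ℕ, ∫⁻ t, trunc N g t ^ (8 : ℝ) ≤ K ^ (8 : ℝ) := fun N => by
    set S := ∫⁻ t, trunc N g t ^ (8 : ℝ) with hS
    have hm := measurable_trunc N hg
    have hb : ∀ t, trunc N g t ≤ (Set.Icc (-(N : ℝ)) N).indicator (fun _ => (N : ℝ≥0∞)) t :=
      fun t => Set.indicator_le_indicator' (fun _ => min_le_right _ _)
    have hfin : S ≠ ∞ := by
      have : S ≤ ∫⁻ t in Set.Icc (-(N : ℝ)) N, (N : ℝ≥0∞) ^ (8 : ℝ) := by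
        rw [← lintegral_indicator measurableSet_Icc]
        refine lintegral_mono fun t => ?_
        refine (ENNReal.rpow_le_rpow (hb t) (by norm_num)).trans (le_of_eq ?_)
        by_cases ht : t ∈ Set.Icc (-(N : ℝ)) N <;> simp [ht]
      refine (this.trans_lt ?_).ne
      rw [setLIntegral_const]
      exact ENNReal.mul_lt_top (by simp) (by simp [Real.volume_Icc])
    have ht : IsTest fun t => trunc N g t ^ (7 : ℝ) := by
      -- One number has to bound both the support radius N and the height N⁷, hence the sum.
      refine ⟨hm.pow_const _, (N : ℝ≥0) + (N : ℝ≥0) ^ (7 : ℝ), fun t => ?_⟩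
      refine (ENNReal.rpow_le_rpow (hb t) (by norm_num : (0 : ℝ) ≤ 7)).trans ?_
      by_cases ht : t ∈ Set.Icc (-(N : ℝ)) N
      · have hle : (N : ℝ) ≤ ((N + N ^ (7 : ℝ) : ℝ≥0) : ℝ) := by
          push_cast
          have : (0 : ℝ) ≤ (N : ℝ) ^ (7 : ℝ) := by positivity
          linarith
        rw [Set.indicator_of_mem ht, Set.indicator_of_mem (Set.Icc_subset_Icc (by linarith) hle ht)]
        rw [ENNReal.coe_add, ENNReal.coe_rpow_of_nonneg _ (by norm_num)]
        simp
      · rw [Set.indicator_of_notMem ht]; simp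
    have h1 : S ≤ K * S ^ (7 / 8 : ℝ) := by
      calc S = ∫⁻ t, trunc N g t ^ (7 : ℝ) * trunc N g t := by
            refine lintegral_congr fun t => ?_
            rw [show (8 : ℝ) = 7 + 1 by norm_num,
              ENNReal.rpow_add_of_nonneg _ _ (by norm_num) (by norm_num), ENNReal.rpow_one]
        _ ≤ ∫⁻ t, trunc N g t ^ (7 : ℝ) * g t :=
            lintegral_mono fun t => by have := trunc_le N g t; gcongr
        _ ≤ K * dualNorm fun t => trunc N g t ^ (7 : ℝ) := h _ ht
        _ = K * S ^ (7 / 8 : ℝ) := by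
            simp only [dualNorm, ← ENNReal.rpow_mul]
            norm_num [hS]
    rcases eq_or_ne S 0 with h0 | h0
    · rw [h0]; exact zero_le
    have h2 : S ^ (1 / 8 : ℝ) ≤ K := by
      have h3 : S ^ (1 / 8 : ℝ) * S ^ (7 / 8 : ℝ) ≤ K * S ^ (7 / 8 : ℝ) := by
        rw [← ENNReal.rpow_add _ _ h0 hfin]
        norm_num
        exact h1
      refine (ENNReal.mul_le_mul_iff_left ?_ ?_).1 h3
      · simp [h0, hfin]
      · exact ENNReal.rpow_ne_top_of_nonneg (by norm_num) hfin
    calc S = (S ^ (1 / 8 : ℝ)) ^ (8 : ℝ) := by rw [← ENNReal.rpow_mul]; norm_num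
      _ ≤ K ^ (8 : ℝ) := by gcongr
  have hsup : ∀ t, g t ^ (8 : ℝ) = ⨆ N, trunc N g t ^ (8 : ℝ) := fun t => by
    conv_lhs => rw [← iSup_trunc g t]
    exact (ENNReal.orderIsoRpow 8 (by norm_num)).map_iSup _
  simp_rw [hsup]
  rw [lintegral_iSup (fun N => (measurable_trunc N hg).pow_const _)
    fun M N hMN t => ENNReal.rpow_le_rpow (monotone_trunc g hMN t) (by norm_num)]
  exact iSup_le hN

/-! ### Strichartz estimates for the free group -/

/-- The coordinate functional `x ↦ x n` on `ℓ²(ℤ)`. -/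
def coord (n : ℤ) : EllTwo →L[ℂ] ℂ := lp.evalCLM ℂ (fun _ : ℤ => ℂ) 2 n

theorem coord_apply (n : ℤ) (x : EllTwo) : coord n x = (x : ℤ → ℂ) n := rfl

theorem enorm_apply_le (x : EllTwo) (n : ℤ) : ‖(x : ℤ → ℂ) n‖ₑ ≤ ‖x‖ₑ := by
  rw [← ofReal_norm, ← ofReal_norm]
  exact ENNReal.ofReal_le_ofReal (lp.norm_apply_le_norm (by norm_num) x n)

theorem ellNorm_top_le_enorm (x : EllTwo) : ellNorm ∞ (x : ℤ → ℂ) ≤ ‖x‖ₑ := by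
  rw [ellNorm_top]
  exact iSup_le fun n => enorm_apply_le x n

theorem enorm_freeGroup (t : ℝ) (x : EllTwo) : ‖freeGroup t x‖ₑ = ‖x‖ₑ := by
  rw [← ofReal_norm, norm_freeGroup_apply, ofReal_norm]

theorem ellNorm_top_freeGroup_le (t : ℝ) (x : EllTwo) :
    ellNorm ∞ (freeGroup t x : ℤ → ℂ) ≤ 4 * (rieszKernel t * ellNorm 1 (x : ℤ → ℂ)) := by
  rw [ellNorm_top]
  refine iSup_le fun n => ?_
  -- At t = 0 the kernel takes the value ∞, so only x = 0 needs an argument.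
  rcases eq_or_ne t 0 with rfl | ht
  · rcases eq_or_ne (ellNorm 1 (x : ℤ → ℂ)) 0 with h | h
    · have hx : x = 0 := by
        rw [ellNorm_one, ENNReal.tsum_eq_zero] at h
        ext n
        simpa using h n
      simp [hx]
    · have : rieszKernel 0 = ∞ := by simp [rieszKernel]
      rw [this, ENNReal.top_mul h, ENNReal.mul_top (by norm_num)]
      exact le_top
  · rw [rieszKernel_of_ne ht, ← mul_assoc]
    exact enorm_freeGroup_apply_le ht x n

theorem measurable_ellNorm_one {α : Type*} [MeasurableSpace α] {G : α → EllTwo}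
    (hG : StronglyMeasurable G) : Measurable fun t => ellNorm 1 (G t : ℤ → ℂ) := by
  simp_rw [ellNorm_one]
  exact Measurable.tsum fun n =>
    ((coord n).continuous.comp_stronglyMeasurable hG).measurable.enorm

theorem measurable_ellNorm_top {α : Type*} [MeasurableSpace α] {G : α → EllTwo}
    (hG : StronglyMeasurable G) : Measurable fun t => ellNorm ∞ (G t : ℤ → ℂ) := by
  simp_rw [ellNorm_top]
  exact Measurable.iSup fun n =>
    ((coord n).continuous.comp_stronglyMeasurable hG).measurable.enorm

theorem stronglyMeasurable_freeGroup_apply {α : Type*} [MeasurableSpace α] {τ : α → ℝ}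
    (hτ : Measurable τ) {G : α → EllTwo} (hG : StronglyMeasurable G) :
    StronglyMeasurable fun a => freeGroup (τ a) (G a) :=
  (isBoundedBilinearMap_apply (𝕜 := ℂ) (E := EllTwo) (F := EllTwo)).continuous.comp_stronglyMeasurable
    ((continuous_freeGroup.stronglyMeasurable.comp_measurable hτ).prodMk hG)

theorem integrable_freeGroup_neg {μ : Measure ℝ} {G : ℝ → EllTwo} (hG : StronglyMeasurable G)
    (hi : Integrable G μ) : Integrable (fun s => freeGroup (-s) (G s)) μ :=
  hi.mono (stronglyMeasurable_freeGroup_apply measurable_neg hG).aestronglyMeasurable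
    (Filter.Eventually.of_forall fun _ => (norm_freeGroup_apply _ _).le)

theorem ellNorm_top_freeGroup_integral_le {μ : Measure ℝ} {G : ℝ → EllTwo}
    (hG : StronglyMeasurable G) (hi : Integrable G μ) (t : ℝ) :
    ellNorm ∞ (freeGroup t (∫ s, freeGroup (-s) (G s) ∂μ) : ℤ → ℂ)
      ≤ ∫⁻ s, ellNorm ∞ (freeGroup (t - s) (G s) : ℤ → ℂ) ∂μ := by
  rw [ellNorm_top]
  refine iSup_le fun n => ?_
  have hU := integrable_freeGroup_neg hG hi
  rw [← ContinuousLinearMap.integral_comp_comm _ hU, ← coord_apply,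
    ← ContinuousLinearMap.integral_comp_comm _ ((freeGroup t).integrable_comp hU)]
  refine (enorm_integral_le_lintegral_enorm _).trans (lintegral_mono fun s => ?_)
  rw [← freeGroup_add_apply, ← sub_eq_add_neg, coord_apply, ellNorm_top]
  exact le_iSup (fun n => ‖(freeGroup (t - s) (G s) : ℤ → ℂ) n‖ₑ) n

theorem ellNorm_top_freeGroup_integral_le_rieszPotential {G : ℝ → EllTwo}
    (hG : StronglyMeasurable G) {S : Set ℝ} (hi : IntegrableOn G S) (t : ℝ) :
    ellNorm ∞ (freeGroup t (∫ s in S, freeGroup (-s) (G s)) : ℤ → ℂ)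
      ≤ 4 * rieszPotential (fun s => ellNorm 1 (G s : ℤ → ℂ)) t := by
  refine (ellNorm_top_freeGroup_integral_le hG hi t).trans ?_
  refine (setLIntegral_le_lintegral _ _).trans ?_
  rw [rieszPotential, ← lintegral_const_mul]
  · exact lintegral_mono fun s => ellNorm_top_freeGroup_le _ _
  · exact (measurable_rieszKernel.comp (by fun_prop)).mul (measurable_ellNorm_one hG)

/-- The dual Strichartz estimate, by the `TT*` argument. -/
theorem enorm_integral_freeGroup_neg_le {G : ℝ → EllTwo} (hG : StronglyMeasurable G)
    {S : Set ℝ} (hi : IntegrableOn G S) :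
    ‖∫ s in S, freeGroup (-s) (G s)‖ₑ ≤ 13 * dualNorm fun s => ellNorm 1 (G s : ℤ → ℂ) := by
  set g : ℝ → ℝ≥0∞ := fun s => ellNorm 1 (G s : ℤ → ℂ) with hg
  have hgm : Measurable g := measurable_ellNorm_one hG
  set z := ∫ s in S, freeGroup (-s) (G s) with hz
  have h1 : ‖z‖ₑ ^ 2 = ‖inner ℂ z z‖ₑ := by
    rw [inner_self_eq_norm_sq_to_K, enorm_pow]
    simp [← ofReal_norm]
  have h2 : inner ℂ z z = ∫ s in S, inner ℂ z (freeGroup (-s) (G s)) := by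
    rw [integral_inner (integrable_freeGroup_neg hG hi)]
  -- The group is moved onto z. The resulting e^{-isΔ²}z is controlled in ℓ^∞ by the fractional
  -- integral of g, and G(s) is paired with it through its ℓ¹ norm.
  have h3 : ∀ s, ‖inner ℂ z (freeGroup (-s) (G s))‖ₑ ≤ 4 * (g s * rieszPotential g s) := fun s => by
    have e : ‖inner ℂ z (freeGroup (-s) (G s))‖ₑ = ‖inner ℂ (G s) (freeGroup s z)‖ₑ := by
      rw [← inner_freeGroup_left, ← ofReal_norm, norm_inner_symm, ofReal_norm]
    rw [e, mul_left_comm]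
    refine (enorm_inner_le _ _).trans (mul_le_mul_right ?_ _)
    rw [← ellNorm_top]
    exact ellNorm_top_freeGroup_integral_le_rieszPotential hG hi s
  have h4 : ‖z‖ₑ ^ 2 ≤ 160 * dualNorm g * dualNorm g := by
    rw [h1, h2]
    refine (enorm_integral_le_lintegral_enorm _).trans ?_
    refine (setLIntegral_le_lintegral _ _).trans ((lintegral_mono h3).trans ?_)
    have hm := measurable_rieszPotential hgm
    rw [lintegral_const_mul _ (by fun_prop)]
    refine (mul_le_mul_right (lintegral_mul_rieszPotential_le hgm hgm) _).trans (le_of_eq ?_)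
    rw [← mul_assoc, ← mul_assoc]
    norm_num
  -- 160 ≤ 169 = 13².
  have h5 : ‖z‖ₑ ^ 2 ≤ (13 * dualNorm g) ^ 2 := by
    refine h4.trans ?_
    rw [mul_pow, mul_assoc, ← sq]
    gcongr
    norm_num
  exact (ENNReal.pow_le_pow_left_iff (by norm_num)).1 h5

theorem continuous_single : Continuous fun p : ℤ × ℂ => (lp.single 2 p.1 p.2 : EllTwo) := by
  rw [continuous_prod_of_discrete_left]
  intro n
  exact (lp.isometry_single (E := fun _ : ℤ => ℂ) (p := 2) n).continuous

theorem ellNorm_one_single (n : ℤ) (c : ℂ) :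
    ellNorm 1 (lp.single 2 n c : EllTwo) = ‖c‖ₑ := by
  rw [ellNorm_one, tsum_eq_single n fun m hm => by
    rw [lp.single_apply_ne _ _ _ hm, enorm_zero], lp.single_apply_self]

/-- A measurable choice of an almost maximal coordinate. -/
theorem exists_measurable_almost_max {f : ℤ → ℝ → ℝ≥0∞} (hf : ∀ n, Measurable (f n))
    (hfin : ∀ t, ⨆ n, f n t < ∞) :
    ∃ ν : ℝ → ℤ, Measurable ν ∧ ∀ t, ⨆ n, f n t ≤ 2 * f (ν t) t := by
  classical
  have hex : ∀ t, ∃ k : ℕ, ⨆ n, f n t ≤ 2 * f (Equiv.intEquivNat.symm k) t := fun t => by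
    rcases eq_or_ne (⨆ n, f n t) 0 with h | h
    · exact ⟨0, by rw [h]; exact zero_le⟩
    · obtain ⟨n, hn⟩ := lt_iSup_iff.1 (ENNReal.half_lt_self h (hfin t).ne)
      refine ⟨Equiv.intEquivNat n, ?_⟩
      rw [Equiv.symm_apply_apply]
      rw [ENNReal.div_lt_iff (by simp) (by simp), mul_comm] at hn
      exact hn.le
  -- Taking the least index in an enumeration of ℤ makes the selection measurable.
  refine ⟨fun t => Equiv.intEquivNat.symm (Nat.find (hex t)), ?_, fun t => Nat.find_spec (hex t)⟩
  refine (measurable_from_top (f := Equiv.intEquivNat.symm)).comp (measurable_find hex fun k => ?_)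
  exact measurableSet_le (Measurable.iSup hf) ((hf _).const_mul _)

theorem measurable_comp_index {f : ℤ → ℝ → ℂ} (hf : ∀ n, Measurable (f n)) {ν : ℝ → ℤ}
    (hν : Measurable ν) : Measurable fun t => f (ν t) t := by
  have h1 : Measurable fun p : ℤ × ℝ => f p.1 p.2 := measurable_from_prod_countable_right hf
  exact h1.comp (hν.prodMk measurable_id')

/-- The homogeneous Strichartz estimate in `L^8_t ℓ^∞`, in dual form. -/
theorem lintegral_mul_ellNorm_top_freeGroup_le (φ : EllTwo) {w : ℝ → ℝ≥0∞} (hw : IsTest w) :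
    ∫⁻ t, w t * ellNorm ∞ (freeGroup t φ : ℤ → ℂ) ≤ 26 * ‖φ‖ₑ * dualNorm w := by
  obtain ⟨hwm, R, hR⟩ := hw
  have hsm : StronglyMeasurable fun t => freeGroup t φ :=
    stronglyMeasurable_freeGroup_apply measurable_id stronglyMeasurable_const
  have hcm : ∀ n, Measurable fun t => (freeGroup t φ : ℤ → ℂ) n := fun n =>
    ((coord n).continuous.comp_stronglyMeasurable hsm).measurable
  obtain ⟨ν, hνm, hν⟩ := exists_measurable_almost_max (f := fun n t => ‖(freeGroup t φ : ℤ → ℂ) n‖ₑ)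
    (fun n => (hcm n).enorm) fun t => by
      refine (iSup_le fun n => (enorm_apply_le _ n).trans (enorm_freeGroup t φ).le).trans_lt ?_
      exact enorm_lt_top
  have hwle : ∀ t, w t ≤ R := fun t => (hR t).trans (Set.indicator_apply_le' (fun _ => le_rfl)
    fun _ => zero_le)
  have hwfin : ∀ t, w t ≠ ∞ := fun t => ((hwle t).trans_lt ENNReal.coe_lt_top).ne
  -- The supremum over n is linearised: ζ is the value at an almost maximal coordinate ν, and c
  -- carries the weight w and the phase of ζ (it vanishes where ζ does, since division by zero gives
  -- 0). Then G = c·δ_ν has ℓ¹ norm at most w and pairs with the evolution of φ to w|ζ|, so the dual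
  -- estimate applies to G. The factor 26 is 2 · 13.
  set ζ : ℝ → ℂ := fun t => (freeGroup t φ : ℤ → ℂ) (ν t) with hζ
  have hζm : Measurable ζ := measurable_comp_index hcm hνm
  set c : ℝ → ℂ := fun t => ((w t).toReal : ℂ) * (ζ t / ‖ζ t‖) with hc
  have hcmeas : Measurable c := by
    have := hζm.norm
    fun_prop
  have hcn : ∀ t, ‖c t‖ ≤ (w t).toReal := fun t => by
    simp only [hc]
    rw [norm_mul, Complex.norm_real, Real.norm_of_nonneg ENNReal.toReal_nonneg, norm_div,
      Complex.norm_real, norm_norm]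
    exact mul_le_of_le_one_right ENNReal.toReal_nonneg (div_self_le_one _)
  set G : ℝ → EllTwo := fun t => lp.single 2 (ν t) (c t) with hG
  have hGm : StronglyMeasurable G :=
    continuous_single.comp_stronglyMeasurable (hνm.prodMk hcmeas).stronglyMeasurable
  have hGn : ∀ t, ‖G t‖ = ‖c t‖ := fun t => lp.norm_single (by norm_num) _ _
  have hGi : Integrable G := by
    refine Integrable.mono' (g := (Set.Icc (-(R : ℝ)) R).indicator fun _ => (R : ℝ)) ?_
      hGm.aestronglyMeasurable (Filter.Eventually.of_forall fun t => ?_)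
    · exact (integrable_indicator_iff measurableSet_Icc).2 (integrableOn_const (by simp))
    · rw [hGn]
      refine (hcn t).trans ?_
      refine (ENNReal.toReal_mono ?_ (hR t)).trans (le_of_eq ?_)
      · by_cases h : t ∈ Set.Icc (-(R : ℝ)) R <;> simp [h]
      · by_cases h : t ∈ Set.Icc (-(R : ℝ)) R <;> simp [h]
  have hpair : ∀ t, inner ℂ (freeGroup (-t) (G t)) φ = (((w t).toReal * ‖ζ t‖ : ℝ) : ℂ) := fun t => by
    rw [inner_freeGroup_left, neg_neg, hG]
    simp only
    rw [lp.inner_single_left, RCLike.inner_apply]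
    change ζ t * (starRingEnd ℂ) (c t) = _
    simp only [hc, map_mul, map_div₀, Complex.conj_ofReal]
    rcases eq_or_ne (ζ t) 0 with h | h
    · simp [h]
    · have hn : (‖ζ t‖ : ℂ) ≠ 0 := by simpa using h
      have := Complex.mul_conj (ζ t)
      rw [Complex.normSq_eq_norm_sq] at this
      push_cast at this ⊢
      field_simp
      linear_combination ((w t).toReal : ℂ) * this
  have hUi := integrable_freeGroup_neg hGm hGi
  have hint : Integrable fun t => (w t).toReal * ‖ζ t‖ := by
    have h1 := hUi.inner_const (𝕜 := ℂ) φ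
    simp_rw [hpair] at h1
    exact h1.re
  set z := ∫ s, freeGroup (-s) (G s) with hz
  have hzb : ‖z‖ₑ ≤ 13 * dualNorm w := by
    have h1 := enorm_integral_freeGroup_neg_le hGm (S := Set.univ) hGi.integrableOn
    rw [setIntegral_univ] at h1
    refine h1.trans (mul_le_mul_right (dualNorm_mono fun t => ?_) _)
    rw [hG, ellNorm_one_single, ← ofReal_norm]
    exact ENNReal.ofReal_le_of_le_toReal (hcn t)
  have hzφ : inner ℂ z φ = ((∫ t, (w t).toReal * ‖ζ t‖ : ℝ) : ℂ) := by
    rw [← inner_conj_symm, hz, ← integral_inner hUi, ← integral_conj, ← integral_complex_ofReal]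
    refine integral_congr_ae (Filter.Eventually.of_forall fun t => ?_)
    simp only
    rw [inner_conj_symm, hpair]
  have hfinal : ∫⁻ t, w t * ‖ζ t‖ₑ = ‖inner ℂ z φ‖ₑ := by
    have hnn : 0 ≤ ∫ t, (w t).toReal * ‖ζ t‖ := integral_nonneg fun t => by positivity
    rw [hzφ, ← ofReal_norm, Complex.norm_real, Real.norm_of_nonneg hnn,
      ofReal_integral_eq_lintegral_ofReal hint (Filter.Eventually.of_forall fun t => by positivity)]
    refine lintegral_congr fun t => ?_
    rw [ENNReal.ofReal_mul ENNReal.toReal_nonneg, ENNReal.ofReal_toReal (hwfin t), ofReal_norm]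
  calc ∫⁻ t, w t * ellNorm ∞ (freeGroup t φ : ℤ → ℂ) ≤ ∫⁻ t, 2 * (w t * ‖ζ t‖ₑ) := by
        refine lintegral_mono fun t => ?_
        rw [mul_left_comm, ellNorm_top]
        exact mul_le_mul_right (hν t) _
    _ = 2 * ‖inner ℂ z φ‖ₑ := by
        have := hζm.enorm
        rw [lintegral_const_mul _ (by fun_prop), hfinal]
    _ ≤ 2 * (‖z‖ₑ * ‖φ‖ₑ) := by
        gcongr
        rw [← ofReal_norm, ← ofReal_norm, ← ofReal_norm, ← ENNReal.ofReal_mul (norm_nonneg _)]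
        exact ENNReal.ofReal_le_ofReal (norm_inner_le_norm _ _)
    _ ≤ 2 * (13 * dualNorm w * ‖φ‖ₑ) := by gcongr
    _ = 26 * ‖φ‖ₑ * dualNorm w := by ring

/-! ### Duhamel's formula -/

theorem hasDerivAt_freeGroup_neg_apply {v : ℝ → EllTwo} {v' : EllTwo} {t : ℝ}
    (hv : HasDerivAt v v' t) :
    HasDerivAt (fun s => freeGroup (-s) (v s))
      (freeGroup (-t) (Complex.I • biLaplacian (v t)) + freeGroup (-t) v') t := by
  have h1 : HasDerivAt (fun s : ℝ => freeGroup (-s))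
      ((-1 : ℝ) • (freeGroup (-t) * ((-Complex.I) • biLaplacian))) t :=
    (hasDerivAt_freeGroup (-t)).scomp t (hasDerivAt_neg t)
  have h2 := (ContinuousLinearMap.restrictScalarsL ℂ EllTwo EllTwo ℝ ℝ).hasFDerivAt.comp_hasDerivAt
    t h1
  have h3 := h2.clm_apply hv
  refine h3.congr_deriv ?_
  change (-1 : ℝ) • (freeGroup (-t) ((-Complex.I) • biLaplacian (v t))) + freeGroup (-t) v' = _
  rw [neg_one_smul, neg_smul, map_neg, neg_neg]

theorem continuous_freeGroup_neg_apply {v : ℝ → EllTwo} (hv : Continuous v) :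
    Continuous fun s => freeGroup (-s) (v s) :=
  (isBoundedBilinearMap_apply (𝕜 := ℂ) (E := EllTwo) (F := EllTwo)).continuous.comp
    ((continuous_freeGroup.comp continuous_neg).prodMk hv)

theorem continuous_smul_biLaplacian {v : ℝ → EllTwo} (hv : Continuous v) (c : ℂ) :
    Continuous fun s => c • biLaplacian (v s) :=
  (biLaplacian.continuous.comp hv).const_smul c

theorem norm_intervalIntegral_le_integral {D : ℝ → EllTwo} (hD : Integrable D) (a b : ℝ) :
    ‖∫ s in a..b, D s‖ ≤ ∫ s, ‖D s‖ :=
  (intervalIntegral.norm_integral_le_integral_norm_uIoc).trans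
    (setIntegral_le_integral hD.norm (Filter.Eventually.of_forall fun _ => norm_nonneg _))

theorem continuous_primitive_of_integrable {G : ℝ → EllTwo} (hG : Integrable G) :
    Continuous fun t => ∫ s in (0 : ℝ)..t, G s :=
  intervalIntegral.continuous_primitive (fun _ _ => hG.intervalIntegrable) 0

theorem integrable_freeGroup_neg_of_integrable {μ : Measure ℝ} {G : ℝ → EllTwo}
    (hi : Integrable G μ) : Integrable (fun s => freeGroup (-s) (G s)) μ := by
  refine hi.mono ?_ (Filter.Eventually.of_forall fun _ => (norm_freeGroup_apply _ _).le)
  refine (stronglyMeasurable_freeGroup_apply measurable_neg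
    hi.aestronglyMeasurable.stronglyMeasurable_mk).aestronglyMeasurable.congr ?_
  filter_upwards [hi.aestronglyMeasurable.ae_eq_mk] with s hs
  rw [hs]

theorem freeGroup_neg_primitive_of_continuous {g : ℝ → EllTwo} (hg : Continuous g) (T : ℝ) :
    freeGroup (-T) (∫ s in (0 : ℝ)..T, g s)
      = (∫ s in (0 : ℝ)..T, freeGroup (-s) (Complex.I • biLaplacian (∫ r in (0 : ℝ)..s, g r)))
        + ∫ s in (0 : ℝ)..T, freeGroup (-s) (g s) := by
  have hP : ∀ s, HasDerivAt (fun t => ∫ r in (0 : ℝ)..t, g r) (g s) s := fun s =>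
    intervalIntegral.integral_hasDerivAt_right (hg.intervalIntegrable _ _)
      hg.aestronglyMeasurable.stronglyMeasurableAtFilter hg.continuousAt
  have hPc : Continuous fun t => ∫ r in (0 : ℝ)..t, g r :=
    continuous_iff_continuousAt.2 fun s => (hP s).continuousAt
  have h1 : Continuous fun s => freeGroup (-s) (Complex.I • biLaplacian (∫ r in (0 : ℝ)..s, g r)) :=
    continuous_freeGroup_neg_apply (continuous_smul_biLaplacian hPc _)
  have h2 : Continuous fun s => freeGroup (-s) (g s) := continuous_freeGroup_neg_apply hg
  rw [← intervalIntegral.integral_add (h1.intervalIntegrable _ _) (h2.intervalIntegrable _ _),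
    intervalIntegral.integral_eq_sub_of_hasDerivAt
      (fun s _ => hasDerivAt_freeGroup_neg_apply (hP s)) ((h1.add h2).intervalIntegrable _ _)]
  simp

/-- Integration by parts against the free group. -/
theorem freeGroup_neg_primitive {G : ℝ → EllTwo} (hG : Integrable G) (T : ℝ) :
    freeGroup (-T) (∫ s in (0 : ℝ)..T, G s)
      = (∫ s in (0 : ℝ)..T, freeGroup (-s) (Complex.I • biLaplacian (∫ r in (0 : ℝ)..s, G r)))
        + ∫ s in (0 : ℝ)..T, freeGroup (-s) (G s) := by
  -- The defect of the identity. It respects differences, is bounded by a multiple of the L¹ norm,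
  -- and vanishes for continuous functions; density of these in L¹ then gives W = 0 for integrable
  -- G.
  set W : (ℝ → EllTwo) → EllTwo := fun G => freeGroup (-T) (∫ s in (0 : ℝ)..T, G s)
    - ((∫ s in (0 : ℝ)..T, freeGroup (-s) (Complex.I • biLaplacian (∫ r in (0 : ℝ)..s, G r)))
      + ∫ s in (0 : ℝ)..T, freeGroup (-s) (G s)) with hW
  have hc : ∀ {G : ℝ → EllTwo}, Integrable G → Continuous fun s =>
      freeGroup (-s) (Complex.I • biLaplacian (∫ r in (0 : ℝ)..s, G r)) := fun hG =>
    continuous_freeGroup_neg_apply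
      (continuous_smul_biLaplacian (continuous_primitive_of_integrable hG) _)
  have hsub : ∀ {G g : ℝ → EllTwo}, Integrable G → Integrable g →
      W (fun s => G s - g s) = W G - W g := fun {G g} hG hg => by
    have e1 : ∀ s, ∫ r in (0 : ℝ)..s, (G r - g r)
        = (∫ r in (0 : ℝ)..s, G r) - ∫ r in (0 : ℝ)..s, g r := fun s =>
      intervalIntegral.integral_sub hG.intervalIntegrable hg.intervalIntegrable
    simp only [hW, e1, map_sub, smul_sub]
    rw [intervalIntegral.integral_sub ((hc hG).intervalIntegrable _ _)
      ((hc hg).intervalIntegrable _ _), intervalIntegral.integral_sub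
        (integrable_freeGroup_neg_of_integrable hG).intervalIntegrable
        (integrable_freeGroup_neg_of_integrable hg).intervalIntegrable]
    abel
  have hbound : ∀ {D : ℝ → EllTwo}, Integrable D →
      ‖W D‖ ≤ (2 + ‖biLaplacian‖ * |T|) * ∫ s, ‖D s‖ := fun {D} hD => by
    have b1 : ‖freeGroup (-T) (∫ s in (0 : ℝ)..T, D s)‖ ≤ ∫ s, ‖D s‖ := by
      rw [norm_freeGroup_apply]; exact norm_intervalIntegral_le_integral hD _ _
    have b2 : ‖∫ s in (0 : ℝ)..T, freeGroup (-s) (D s)‖ ≤ ∫ s, ‖D s‖ := by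
      refine (norm_intervalIntegral_le_integral (integrable_freeGroup_neg_of_integrable hD)
        _ _).trans (le_of_eq ?_)
      simp_rw [norm_freeGroup_apply]
    have b3 : ‖∫ s in (0 : ℝ)..T,
        freeGroup (-s) (Complex.I • biLaplacian (∫ r in (0 : ℝ)..s, D r))‖
        ≤ ‖biLaplacian‖ * (∫ s, ‖D s‖) * |T - 0| := by
      refine intervalIntegral.norm_integral_le_of_norm_le_const fun s _ => ?_
      rw [norm_freeGroup_apply, norm_smul, Complex.norm_I, one_mul]
      refine (biLaplacian.le_opNorm _).trans ?_
      gcongr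
      exact norm_intervalIntegral_le_integral hD _ _
    refine (norm_sub_le _ _).trans ((add_le_add b1 ((norm_add_le _ _).trans
      (add_le_add b3 b2))).trans (le_of_eq ?_))
    rw [sub_zero]
    ring
  have hWG : W G = 0 := by
    rw [← norm_le_zero_iff]
    refine le_of_forall_pos_le_add fun ε hε => ?_
    set K := 2 + ‖biLaplacian‖ * |T| with hK
    have hK0 : 0 < K := by positivity
    obtain ⟨g, -, hg1, hg2, hg3⟩ :=
      hG.exists_hasCompactSupport_integral_sub_le (div_pos hε hK0)
    have hWg : W g = 0 := sub_eq_zero.2 (freeGroup_neg_primitive_of_continuous hg2 T)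
    have h1 := hsub hG hg3
    rw [hWg, sub_zero] at h1
    rw [← h1, zero_add]
    refine (hbound (hG.sub hg3)).trans ?_
    calc K * ∫ s, ‖G s - g s‖ ≤ K * (ε / K) := by gcongr
      _ = ε := by field_simp
  exact sub_eq_zero.1 hWG

/-- Write u = v + iP with v continuously differentiable and P the primitive of G, which need not be
differentiable everywhere. Differentiating e^{isΔ²}v(s) leaves only a term in Δ²P, and integration
by parts for P cancels it. -/
theorem duhamel_of_integral_eq {u G : ℝ → EllTwo} (hu : Continuous u) (hG : Integrable G) {T : ℝ}
    (h : ∀ t ∈ Set.uIcc 0 T, u t = u 0 + (-Complex.I) • (∫ s in (0 : ℝ)..t, biLaplacian (u s))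
      + Complex.I • ∫ s in (0 : ℝ)..t, G s) :
    u T = freeGroup T (u 0 + Complex.I • ∫ s in (0 : ℝ)..T, freeGroup (-s) (G s)) := by
  set P : ℝ → EllTwo := fun t => ∫ s in (0 : ℝ)..t, G s with hP
  have hPc : Continuous P := continuous_primitive_of_integrable hG
  have hAu : Continuous fun s => biLaplacian (u s) := biLaplacian.continuous.comp hu
  set v : ℝ → EllTwo := fun t => u 0 + (-Complex.I) • ∫ s in (0 : ℝ)..t, biLaplacian (u s) with hv
  have hvd : ∀ t, HasDerivAt v ((-Complex.I) • biLaplacian (u t)) t := fun t =>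
    ((intervalIntegral.integral_hasDerivAt_right (hAu.intervalIntegrable _ _)
      hAu.aestronglyMeasurable.stronglyMeasurableAtFilter hAu.continuousAt).const_smul
        (-Complex.I)).const_add (u 0)
  have hcP : Continuous fun s => freeGroup (-s) (Complex.I • biLaplacian (P s)) :=
    continuous_freeGroup_neg_apply (continuous_smul_biLaplacian hPc _)
  have hd : ∀ t ∈ Set.uIcc 0 T, HasDerivAt (fun s => freeGroup (-s) (v s))
      ((-Complex.I) • freeGroup (-t) (Complex.I • biLaplacian (P t))) t := fun t ht => by
    refine (hasDerivAt_freeGroup_neg_apply (hvd t)).congr_deriv ?_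
    have hut : u t = v t + Complex.I • P t := h t ht
    rw [hut, ← map_add, ← map_smul (freeGroup (-t))]
    have key : ∀ a b : EllTwo, Complex.I • biLaplacian a + (-Complex.I) •
        biLaplacian (a + Complex.I • b) = (-Complex.I) • Complex.I • biLaplacian b := fun a b => by
      rw [map_add, map_smul]
      module
    exact congrArg _ (key _ _)
  have hftc := intervalIntegral.integral_eq_sub_of_hasDerivAt hd
    ((hcP.const_smul (-Complex.I)).intervalIntegrable _ _)
  rw [intervalIntegral.integral_smul] at hftc
  have hparts := freeGroup_neg_primitive hG T
  have hv0 : v 0 = u 0 := by simp [hv]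
  have huT : u T = v T + Complex.I • P T := h T Set.right_mem_uIcc
  have hfin : freeGroup (-T) (u T)
      = u 0 + Complex.I • ∫ s in (0 : ℝ)..T, freeGroup (-s) (G s) := by
    rw [huT, map_add, map_smul]
    rw [neg_zero, freeGroup_zero, one_apply_eq_self, hv0] at hftc
    have h1 : freeGroup (-T) (v T) = u 0 + (-Complex.I) •
        ∫ s in (0 : ℝ)..T, freeGroup (-s) (Complex.I • biLaplacian (P s)) := by
      rw [hftc]; abel
    rw [h1, show P T = ∫ s in (0 : ℝ)..T, G s from rfl, hparts]
    module
  rw [← hfin, freeGroup_apply_neg]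

theorem AbsolutelyContinuousOnInterval.re_comp {y : ℝ → ℂ} {a b : ℝ}
    (hy : AbsolutelyContinuousOnInterval y a b) :
    AbsolutelyContinuousOnInterval (fun t => (y t).re) a b := by
  rw [absolutelyContinuousOnInterval_iff] at hy ⊢
  intro ε hε
  obtain ⟨δ, hδ, h⟩ := hy ε hε
  refine ⟨δ, hδ, fun E hE hd => lt_of_le_of_lt (Finset.sum_le_sum fun i _ => ?_) (h E hE hd)⟩
  rw [Real.dist_eq, Complex.dist_eq, ← Complex.sub_re]
  exact Complex.abs_re_le_norm _

theorem AbsolutelyContinuousOnInterval.im_comp {y : ℝ → ℂ} {a b : ℝ}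
    (hy : AbsolutelyContinuousOnInterval y a b) :
    AbsolutelyContinuousOnInterval (fun t => (y t).im) a b := by
  rw [absolutelyContinuousOnInterval_iff] at hy ⊢
  intro ε hε
  obtain ⟨δ, hδ, h⟩ := hy ε hε
  refine ⟨δ, hδ, fun E hE hd => lt_of_le_of_lt (Finset.sum_le_sum fun i _ => ?_) (h E hE hd)⟩
  rw [Real.dist_eq, Complex.dist_eq, ← Complex.sub_im]
  exact Complex.abs_im_le_norm _

/-- The fundamental theorem of calculus for complex absolutely continuous functions. -/
theorem integral_eq_sub_of_absolutelyContinuous {y g : ℝ → ℂ} {a b : ℝ}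
    (hy : AbsolutelyContinuousOnInterval y a b) (hg : IntervalIntegrable g volume a b)
    (hd : ∀ᵐ t, HasDerivAt y (g t) t) : ∫ t in a..b, g t = y b - y a := by
  have hre : ∫ t in a..b, (g t).re = (y b).re - (y a).re := by
    rw [← (AbsolutelyContinuousOnInterval.re_comp hy).integral_deriv_eq_sub]
    refine intervalIntegral.integral_congr_ae ?_
    filter_upwards [hd] with t ht _
    exact ((Complex.reCLM.hasFDerivAt.comp_hasDerivAt t ht).deriv).symm
  have him : ∫ t in a..b, (g t).im = (y b).im - (y a).im := by
    rw [← (AbsolutelyContinuousOnInterval.im_comp hy).integral_deriv_eq_sub]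
    refine intervalIntegral.integral_congr_ae ?_
    filter_upwards [hd] with t ht _
    exact ((Complex.imCLM.hasFDerivAt.comp_hasDerivAt t ht).deriv).symm
  apply Complex.ext
  · rw [Complex.sub_re, ← hre]
    exact (Complex.reCLM.intervalIntegral_comp_comm hg).symm
  · rw [Complex.sub_im, ← him]
    exact (Complex.imCLM.intervalIntegral_comp_comm hg).symm

/-- Duhamel's formula for solutions with a locally integrable `ℓ²`-valued source. -/
theorem IsSolution.duhamel {u : ℝ → EllTwo} {F : ℝ → ℤ → ℂ} (hu : IsSolution u F)
    {G : ℝ → EllTwo} (hG : ∀ a b, IntervalIntegrable G volume a b)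
    (hGF : ∀ n, ∀ᵐ t, (G t : ℤ → ℂ) n = F t n) (T : ℝ) :
    u T = freeGroup T (u 0 + Complex.I • ∫ s in (0 : ℝ)..T, freeGroup (-s) (G s)) := by
  have hAu := continuous_smul_biLaplacian hu.continuous (-Complex.I)
  -- The integrated equation in ℓ² is checked coordinate by coordinate, where it is the fundamental
  -- theorem of calculus for absolutely continuous functions.
  have heq : ∀ t, u t = u 0 + (-Complex.I) • (∫ s in (0 : ℝ)..t, biLaplacian (u s))
      + Complex.I • ∫ s in (0 : ℝ)..t, G s := fun t => by
    have hGi : IntervalIntegrable (fun s => Complex.I • G s) volume 0 t := (hG 0 t).smul Complex.I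
    have hint : IntervalIntegrable (fun s => (-Complex.I) • biLaplacian (u s) + Complex.I • G s)
        volume 0 t := (hAu.intervalIntegrable _ _).add hGi
    rw [add_assoc, ← intervalIntegral.integral_smul, ← intervalIntegral.integral_smul,
      ← intervalIntegral.integral_add (hAu.intervalIntegrable _ _) hGi]
    ext n
    have hc : coord n (∫ s in (0 : ℝ)..t, ((-Complex.I) • biLaplacian (u s) + Complex.I • G s))
        = ∫ s in (0 : ℝ)..t, coord n ((-Complex.I) • biLaplacian (u s) + Complex.I • G s) :=
      ((coord n).intervalIntegral_comp_comm hint).symm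
    have hftc := integral_eq_sub_of_absolutelyContinuous (hu.absolutelyContinuous n 0 t)
      (g := fun s => coord n ((-Complex.I) • biLaplacian (u s) + Complex.I • G s))
      ⟨(coord n).integrable_comp hint.1, (coord n).integrable_comp hint.2⟩ (by
        filter_upwards [hu.equation n, hGF n] with s ⟨w, hw, hw'⟩ hs
        convert hw using 1
        change -Complex.I * (biLaplacian (u s) : ℤ → ℂ) n + Complex.I * (G s : ℤ → ℂ) n = w
        rw [hs]
        have hI := Complex.I_mul_I
        linear_combination Complex.I * hw' - w * hI)
    rw [lp.coeFn_add, Pi.add_apply, ← coord_apply n (∫ s in (0 : ℝ)..t, _), hc, hftc]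
    ring
  -- Cutting off outside the times between 0 and T turns local into global integrability without
  -- changing the integrals involved.
  set G' : ℝ → EllTwo := (Set.uIoc 0 T).indicator G with hG'
  have hG'i : Integrable G' :=
    (integrable_indicator_iff measurableSet_uIoc).2 (intervalIntegrable_iff.1 (hG 0 T))
  have hcongr : ∀ t ∈ Set.uIcc 0 T, ∀ s ∈ Set.uIoc 0 t, G s = G' s := fun t ht s hs => by
    rw [hG', Set.indicator_of_mem]
    exact Set.uIoc_subset_uIoc_of_uIcc_subset_uIcc (Set.uIcc_subset_uIcc_left ht) hs
  have hmain := duhamel_of_integral_eq hu.continuous hG'i (T := T) fun t ht => by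
    rw [heq t]
    congr 2
    exact intervalIntegral.integral_congr_ae (Filter.Eventually.of_forall (hcongr t ht))
  rw [hmain]
  congr 3
  refine intervalIntegral.integral_congr_ae (Filter.Eventually.of_forall fun s hs => ?_)
  rw [hcongr T Set.right_mem_uIcc s hs]

/-! ### Inhomogeneous estimates at the two endpoints -/

theorem ellNorm_top_add_le (x y : EllTwo) :
    ellNorm ∞ ((x + y : EllTwo) : ℤ → ℂ) ≤ ellNorm ∞ (x : ℤ → ℂ) + ellNorm ∞ (y : ℤ → ℂ) := by
  simp_rw [ellNorm_top]
  refine iSup_le fun n => ?_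
  rw [lp.coeFn_add, Pi.add_apply]
  exact (enorm_add_le _ _).trans (add_le_add (le_iSup (fun n => ‖(x : ℤ → ℂ) n‖ₑ) n)
    (le_iSup (fun n => ‖(y : ℤ → ℂ) n‖ₑ) n))

theorem ellNorm_top_smul_le {c : ℂ} (hc : ‖c‖ = 1) (x : EllTwo) :
    ellNorm ∞ ((c • x : EllTwo) : ℤ → ℂ) ≤ ellNorm ∞ (x : ℤ → ℂ) := by
  simp_rw [ellNorm_top]
  refine iSup_le fun n => ?_
  rw [lp.coeFn_smul, Pi.smul_apply, enorm_smul]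
  have : ‖c‖ₑ = 1 := by rw [← ofReal_norm, hc, ENNReal.ofReal_one]
  rw [this, one_mul]
  exact le_iSup (fun n => ‖(x : ℤ → ℂ) n‖ₑ) n

/-- For T < 0 the interval integral carries a sign; absorbing it in a unimodular factor treats both
time directions at once. -/
theorem exists_intervalIntegral_eq_smul (f : ℝ → EllTwo) (T : ℝ) :
    ∃ c : ℂ, ‖c‖ = 1 ∧ Complex.I • (∫ s in (0 : ℝ)..T, f s) = c • ∫ s in Set.uIoc 0 T, f s := by
  rw [intervalIntegral.intervalIntegral_eq_integral_uIoc]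
  split_ifs
  · exact ⟨Complex.I, by simp, by simp⟩
  · exact ⟨-Complex.I, by simp, by simp⟩

theorem duhamel_split {u₀ : EllTwo} {G₁ G₂ : ℝ → EllTwo}
    (hi₁ : ∀ a b, IntervalIntegrable G₁ volume a b)
    (hi₂ : ∀ a b, IntervalIntegrable G₂ volume a b) (T : ℝ) :
    ∃ c : ℂ, ‖c‖ = 1 ∧
      freeGroup T (u₀ + Complex.I • ∫ s in (0 : ℝ)..T, freeGroup (-s) (G₁ s + G₂ s))
        = freeGroup T u₀ + (c • freeGroup T (∫ s in Set.uIoc 0 T, freeGroup (-s) (G₁ s))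
          + c • freeGroup T (∫ s in Set.uIoc 0 T, freeGroup (-s) (G₂ s))) := by
  obtain ⟨c, hc, h⟩ := exists_intervalIntegral_eq_smul (fun s => freeGroup (-s) (G₁ s + G₂ s)) T
  refine ⟨c, hc, ?_⟩
  rw [h]
  simp_rw [map_add (freeGroup (-_))]
  rw [integral_add (integrable_freeGroup_neg_of_integrable (intervalIntegrable_iff.1 (hi₁ 0 T)))
    (integrable_freeGroup_neg_of_integrable (intervalIntegrable_iff.1 (hi₂ 0 T)))]
  simp only [map_add, map_smul, smul_add]

theorem enorm_smul_freeGroup {c : ℂ} (hc : ‖c‖ = 1) (t : ℝ) (x : EllTwo) :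
    ‖c • freeGroup t x‖ₑ = ‖x‖ₑ := by
  rw [← ofReal_norm, norm_smul, hc, one_mul, norm_freeGroup_apply, ofReal_norm]

/-- The L^∞_t ℓ² endpoint: unitarity handles the L¹_t ℓ² source, and the dual Strichartz estimate,
valid on any time set, handles the other. -/
theorem enorm_duhamel_le {u₀ : EllTwo} {G₁ G₂ : ℝ → EllTwo} (h₂ : StronglyMeasurable G₂)
    (hi₁ : ∀ a b, IntervalIntegrable G₁ volume a b)
    (hi₂ : ∀ a b, IntervalIntegrable G₂ volume a b) (T : ℝ) :
    ‖freeGroup T (u₀ + Complex.I • ∫ s in (0 : ℝ)..T, freeGroup (-s) (G₁ s + G₂ s))‖ₑ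
      ≤ ‖u₀‖ₑ + ((∫⁻ s, ‖G₁ s‖ₑ) + 13 * dualNorm fun s => ellNorm 1 (G₂ s : ℤ → ℂ)) := by
  obtain ⟨c, hc, h⟩ := duhamel_split (u₀ := u₀) hi₁ hi₂ T
  rw [h]
  refine (enorm_add_le _ _).trans (add_le_add (enorm_freeGroup T u₀).le
    ((enorm_add_le _ _).trans (add_le_add ?_ ?_)))
  · rw [enorm_smul_freeGroup hc]
    refine (enorm_integral_le_lintegral_enorm _).trans ?_
    simp_rw [enorm_freeGroup]
    exact setLIntegral_le_lintegral _ _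
  · rw [enorm_smul_freeGroup hc]
    exact enorm_integral_freeGroup_neg_le h₂ (intervalIntegrable_iff.1 (hi₂ 0 T))

/-- After Tonelli, the inner integral for fixed s is the homogeneous estimate for the datum
e^{isΔ²}G(s), whose norm is that of G(s). -/
theorem lintegral_mul_ellNorm_top_source_le {G : ℝ → EllTwo} (hG : StronglyMeasurable G)
    {w : ℝ → ℝ≥0∞} (hw : IsTest w) :
    ∫⁻ t, w t * ∫⁻ s, ellNorm ∞ (freeGroup (t - s) (G s) : ℤ → ℂ)
      ≤ 26 * (∫⁻ s, ‖G s‖ₑ) * dualNorm w := by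
  have hm : Measurable fun p : ℝ × ℝ => ellNorm ∞ (freeGroup (p.1 - p.2) (G p.2) : ℤ → ℂ) :=
    measurable_ellNorm_top (stronglyMeasurable_freeGroup_apply (by fun_prop)
      (hG.comp_measurable measurable_snd))
  calc ∫⁻ t, w t * ∫⁻ s, ellNorm ∞ (freeGroup (t - s) (G s) : ℤ → ℂ)
      = ∫⁻ t, ∫⁻ s, w t * ellNorm ∞ (freeGroup (t - s) (G s) : ℤ → ℂ) := by
        refine lintegral_congr fun t => ?_
        have hmt : Measurable fun s => ellNorm ∞ (freeGroup (t - s) (G s) : ℤ → ℂ) :=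
          measurable_ellNorm_top (stronglyMeasurable_freeGroup_apply (by fun_prop) hG)
        exact (lintegral_const_mul _ hmt).symm
    _ = ∫⁻ s, ∫⁻ t, w t * ellNorm ∞ (freeGroup (t - s) (G s) : ℤ → ℂ) :=
        lintegral_lintegral_swap ((hw.measurable.comp measurable_fst).mul hm).aemeasurable
    _ ≤ ∫⁻ s, 26 * ‖G s‖ₑ * dualNorm w := by
        refine lintegral_mono fun s => ?_
        have h := lintegral_mul_ellNorm_top_freeGroup_le (freeGroup (-s) (G s)) hw
        rw [enorm_freeGroup] at h
        simpa only [← freeGroup_add_apply, ← sub_eq_add_neg] using h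
    _ = 26 * (∫⁻ s, ‖G s‖ₑ) * dualNorm w := by
        rw [lintegral_mul_const _ (hG.enorm.const_mul _), lintegral_const_mul _ hG.enorm]

/-- The L^8_t ℓ^∞ endpoint, tested against w. Both source terms are first enlarged to integrals over
all s of nonnegative quantities, which disposes of the retarded cut-off; 160 is 4 from the kernel
times 40 from Hardy–Littlewood–Sobolev. -/
theorem lintegral_mul_ellNorm_top_duhamel_le {u₀ : EllTwo} {G₁ G₂ : ℝ → EllTwo}
    (h₁ : StronglyMeasurable G₁) (h₂ : StronglyMeasurable G₂)
    (hi₁ : ∀ a b, IntervalIntegrable G₁ volume a b)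
    (hi₂ : ∀ a b, IntervalIntegrable G₂ volume a b) {w : ℝ → ℝ≥0∞} (hw : IsTest w) :
    ∫⁻ t, w t * ellNorm ∞ (freeGroup t (u₀ + Complex.I • ∫ s in (0 : ℝ)..t,
        freeGroup (-s) (G₁ s + G₂ s)) : ℤ → ℂ)
      ≤ (26 * ‖u₀‖ₑ + (26 * (∫⁻ s, ‖G₁ s‖ₑ)
        + 160 * dualNorm fun s => ellNorm 1 (G₂ s : ℤ → ℂ))) * dualNorm w := by
  set g : ℝ → ℝ≥0∞ := fun s => ellNorm 1 (G₂ s : ℤ → ℂ) with hg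
  have hgm : Measurable g := measurable_ellNorm_one h₂
  have hwm := hw.measurable
  have hpt : ∀ t, ellNorm ∞ (freeGroup t (u₀ + Complex.I • ∫ s in (0 : ℝ)..t,
      freeGroup (-s) (G₁ s + G₂ s)) : ℤ → ℂ) ≤ ellNorm ∞ (freeGroup t u₀ : ℤ → ℂ)
        + ((∫⁻ s, ellNorm ∞ (freeGroup (t - s) (G₁ s) : ℤ → ℂ)) + 4 * rieszPotential g t) :=
    fun t => by
      obtain ⟨c, hc, h⟩ := duhamel_split (u₀ := u₀) hi₁ hi₂ t
      rw [h]
      refine (ellNorm_top_add_le _ _).trans (add_le_add le_rfl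
        ((ellNorm_top_add_le _ _).trans (add_le_add ?_ ?_)))
      · refine (ellNorm_top_smul_le hc _).trans ?_
        exact (ellNorm_top_freeGroup_integral_le h₁ (intervalIntegrable_iff.1 (hi₁ 0 t)) t).trans
          (setLIntegral_le_lintegral _ _)
      · exact (ellNorm_top_smul_le hc _).trans (ellNorm_top_freeGroup_integral_le_rieszPotential h₂
          (intervalIntegrable_iff.1 (hi₂ 0 t)) t)
  have hm0 : Measurable fun t => ellNorm ∞ (freeGroup t u₀ : ℤ → ℂ) :=
    measurable_ellNorm_top (stronglyMeasurable_freeGroup_apply measurable_id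
      stronglyMeasurable_const)
  have hm1 : Measurable fun t => ∫⁻ s, ellNorm ∞ (freeGroup (t - s) (G₁ s) : ℤ → ℂ) :=
    Measurable.lintegral_prod_right'
      (f := fun p : ℝ × ℝ => ellNorm ∞ (freeGroup (p.1 - p.2) (G₁ p.2) : ℤ → ℂ))
      (measurable_ellNorm_top (stronglyMeasurable_freeGroup_apply (by fun_prop)
        (h₁.comp_measurable measurable_snd)))
  have hm2 := measurable_rieszPotential hgm
  calc _ ≤ ∫⁻ t, (w t * ellNorm ∞ (freeGroup t u₀ : ℤ → ℂ)
        + (w t * (∫⁻ s, ellNorm ∞ (freeGroup (t - s) (G₁ s) : ℤ → ℂ))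
          + 4 * (w t * rieszPotential g t))) := by
        refine lintegral_mono fun t => (mul_le_mul_right (hpt t) _).trans (le_of_eq ?_)
        ring
    _ = (∫⁻ t, w t * ellNorm ∞ (freeGroup t u₀ : ℤ → ℂ))
        + ((∫⁻ t, w t * (∫⁻ s, ellNorm ∞ (freeGroup (t - s) (G₁ s) : ℤ → ℂ)))
          + 4 * ∫⁻ t, w t * rieszPotential g t) := by
        rw [lintegral_add_left (by fun_prop), lintegral_add_left (by fun_prop),
          lintegral_const_mul _ (by fun_prop)]
    _ ≤ 26 * ‖u₀‖ₑ * dualNorm w + (26 * (∫⁻ s, ‖G₁ s‖ₑ) * dualNorm w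
          + 4 * (40 * dualNorm w * dualNorm g)) := by
        refine add_le_add (lintegral_mul_ellNorm_top_freeGroup_le _ hw) (add_le_add
          (lintegral_mul_ellNorm_top_source_le h₁ hw) (mul_le_mul_right
            (lintegral_mul_rieszPotential_le hwm hgm) _))
    _ = _ := by ring

/-! ### Splitting of the source -/

theorem ellNorm_ofReal {ρ : ℝ} (hρ : 0 < ρ) (φ : ℤ → ℂ) :
    ellNorm (ENNReal.ofReal ρ) φ = (∑' n, ‖φ n‖ₑ ^ ρ) ^ (1 / ρ) := by
  rw [ellNorm, eLpNorm_eq_lintegral_rpow_enorm_toReal (by simpa using hρ) ENNReal.ofReal_ne_top,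
    ENNReal.toReal_ofReal hρ.le, lintegral_count]

theorem ellNorm_two (φ : ℤ → ℂ) : ellNorm 2 φ = (∑' n, ‖φ n‖ₑ ^ (2 : ℝ)) ^ (1 / 2 : ℝ) := by
  have := ellNorm_ofReal (ρ := 2) (by norm_num) φ
  rwa [ENNReal.ofReal_ofNat] at this

theorem ellNorm_two_eq_enorm (x : EllTwo) : ellNorm 2 (x : ℤ → ℂ) = ‖x‖ₑ := by
  have hs : Summable fun n => ‖(x : ℤ → ℂ) n‖ ^ (2 : ℝ) := by
    simpa using (lp.memℓp x).summable (by norm_num)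
  have h := lp.norm_eq_tsum_rpow (p := 2) (by norm_num) x
  simp only [ENNReal.toReal_ofNat] at h
  rw [ellNorm_two, ← ofReal_norm x, h,
    ← ENNReal.ofReal_rpow_of_nonneg (tsum_nonneg fun n => by positivity) (by norm_num),
    ENNReal.ofReal_tsum_of_nonneg (fun n => by positivity) hs]
  congr 2
  ext n
  rw [← ENNReal.ofReal_rpow_of_nonneg (norm_nonneg _) (by norm_num), ofReal_norm]

theorem ellNorm_rpow_ofReal {ρ : ℝ} (hρ : 0 < ρ) (φ : ℤ → ℂ) :
    ellNorm (ENNReal.ofReal ρ) φ ^ ρ = ∑' n, ‖φ n‖ₑ ^ ρ := by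
  rw [ellNorm_ofReal hρ, ← ENNReal.rpow_mul, one_div_mul_cancel hρ.ne', ENNReal.rpow_one]

theorem enorm_le_ellNorm_ofReal {ρ : ℝ} (hρ : 0 < ρ) (φ : ℤ → ℂ) (n : ℤ) :
    ‖φ n‖ₑ ≤ ellNorm (ENNReal.ofReal ρ) φ := by
  refine (ENNReal.rpow_le_rpow_iff hρ).1 ?_
  rw [ellNorm_rpow_ofReal hρ]
  exact ENNReal.le_tsum n

theorem ellNorm_antitone_ofReal {ρ σ : ℝ} (hρ : 0 < ρ) (h : ρ ≤ σ) (φ : ℤ → ℂ) :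
    ellNorm (ENNReal.ofReal σ) φ ≤ ellNorm (ENNReal.ofReal ρ) φ := by
  have hσ := hρ.trans_le h
  refine (ENNReal.rpow_le_rpow_iff hσ).1 ?_
  set N := ellNorm (ENNReal.ofReal ρ) φ with hN
  have h1 : N ^ σ = N ^ ρ * N ^ (σ - ρ) := by
    rw [← ENNReal.rpow_add_of_nonneg _ _ hρ.le (sub_nonneg.2 h), add_sub_cancel]
  rw [ellNorm_rpow_ofReal hσ, h1, hN, ellNorm_rpow_ofReal hρ, ← ENNReal.tsum_mul_right]
  refine ENNReal.tsum_le_tsum fun n => ?_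
  have h2 : ‖φ n‖ₑ ^ σ = ‖φ n‖ₑ ^ ρ * ‖φ n‖ₑ ^ (σ - ρ) := by
    rw [← ENNReal.rpow_add_of_nonneg _ _ hρ.le (sub_nonneg.2 h), add_sub_cancel]
  rw [h2]
  have := enorm_le_ellNorm_ofReal hρ φ n
  have h3 := sub_nonneg.2 h
  gcongr

theorem memℓp_two_of_ellNorm_lt_top {φ : ℤ → ℂ} (h : ellNorm 2 φ < ∞) : Memℓp φ 2 := by
  refine memℓp_gen ?_
  have h1 : ∑' n, ‖φ n‖ₑ ^ (2 : ℝ) ≠ ∞ := by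
    intro h0
    rw [ellNorm_two, h0] at h
    simp at h
  have h2 := ENNReal.summable_toReal h1
  simpa [← ENNReal.toReal_rpow] using h2

/-- A family of measurable coordinate functions that is square summable at almost every time
comes from a strongly measurable `ℓ²`-valued function. -/
theorem exists_stronglyMeasurable_of_coords {f : ℝ → ℤ → ℂ} (hf : ∀ n, Measurable fun t => f t n)
    (hfin : ∀ᵐ t, ellNorm 2 (f t) < ∞) :
    ∃ G : ℝ → EllTwo, StronglyMeasurable G ∧ ∀ᵐ t, (G t : ℤ → ℂ) = f t := by
  classical
  set G₀ : ℝ → EllTwo := fun t => if h : Memℓp (f t) 2 then ⟨f t, h⟩ else 0 with hG₀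
  have hG₀f : ∀ᵐ t, (G₀ t : ℤ → ℂ) = f t := by
    filter_upwards [hfin] with t ht
    simp only [hG₀]
    rw [dif_pos (memℓp_two_of_ellNorm_lt_top ht)]
  -- Finite coordinate sums are strongly measurable and converge to the full sequence in ℓ² at
  -- almost every time.
  have hm : AEStronglyMeasurable G₀ volume := by
    refine aestronglyMeasurable_of_tendsto_ae (Filter.atTop : Filter (Finset ℤ))
      (f := fun s t => ∑ n ∈ s, (lp.single 2 n (f t n) : EllTwo)) (fun s => ?_) ?_
    · refine Finset.aestronglyMeasurable_fun_sum s fun n _ => ?_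
      exact (continuous_single.comp_stronglyMeasurable
        (measurable_const.prodMk (hf n)).stronglyMeasurable).aestronglyMeasurable
    · filter_upwards [hG₀f] with t ht
      have := lp.hasSum_single (p := 2) (by norm_num) (G₀ t)
      rw [ht] at this
      exact this
  refine ⟨hm.mk G₀, hm.stronglyMeasurable_mk, ?_⟩
  filter_upwards [hG₀f, hm.ae_eq_mk] with t h1 h2
  rw [← h2, h1]

theorem measurable_ellNorm_ofReal {f : ℝ → ℤ → ℂ} (hf : ∀ n, Measurable fun t => f t n) {ρ : ℝ}
    (hρ : 0 < ρ) : Measurable fun t => ellNorm (ENNReal.ofReal ρ) (f t) := by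
  simp_rw [ellNorm_ofReal hρ]
  exact (Measurable.tsum fun n => (hf n).enorm.pow_const _).pow_const _

/-- Where |φ| ≤ b, the surplus factor |φ|^{2−ρ} is at most b^{2−ρ}. -/
theorem ellNorm_two_small_part_le {ρ : ℝ} (h1 : 1 ≤ ρ) (h2 : ρ ≤ 2) (φ : ℤ → ℂ) (b : ℝ≥0∞) :
    ellNorm 2 (fun n => if ‖φ n‖ₑ ≤ b then φ n else 0)
      ≤ (ellNorm (ENNReal.ofReal ρ) φ ^ ρ * b ^ (2 - ρ)) ^ (1 / 2 : ℝ) := by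
  have hρ : 0 < ρ := by linarith
  rw [ellNorm_two, ellNorm_rpow_ofReal hρ, ← ENNReal.tsum_mul_right]
  refine ENNReal.rpow_le_rpow (ENNReal.tsum_le_tsum fun n => ?_) (by norm_num)
  split_ifs with h
  · have e : ‖φ n‖ₑ ^ (2 : ℝ) = ‖φ n‖ₑ ^ ρ * ‖φ n‖ₑ ^ (2 - ρ) := by
      rw [← ENNReal.rpow_add_of_nonneg _ _ hρ.le (sub_nonneg.2 h2), add_sub_cancel]
    rw [e]
    have := sub_nonneg.2 h2
    gcongr
  · simp

/-- Where |φ| > b, the factor |φ|^{1−ρ}, of nonpositive exponent, is at most b^{1−ρ}. -/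
theorem ellNorm_one_large_part_le {ρ : ℝ} (h1 : 1 ≤ ρ) (φ : ℤ → ℂ)
    {b : ℝ≥0∞} (hb : b ≠ 0) :
    ellNorm 1 (fun n => if ‖φ n‖ₑ ≤ b then 0 else φ n)
      ≤ ellNorm (ENNReal.ofReal ρ) φ ^ ρ * b ^ (1 - ρ) := by
  have hρ : 0 < ρ := by linarith
  rw [ellNorm_one, ellNorm_rpow_ofReal hρ, ← ENNReal.tsum_mul_right]
  refine ENNReal.tsum_le_tsum fun n => ?_
  split_ifs with h
  · simp
  · rw [not_le] at h
    have h0 : ‖φ n‖ₑ ≠ 0 := (hb.bot_lt.trans h).ne'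
    have e : ‖φ n‖ₑ = ‖φ n‖ₑ ^ ρ * ‖φ n‖ₑ ^ (1 - ρ) := by
      rw [← ENNReal.rpow_add _ _ h0 enorm_ne_top, add_sub_cancel, ENNReal.rpow_one]
    calc ‖φ n‖ₑ = ‖φ n‖ₑ ^ ρ * ‖φ n‖ₑ ^ (1 - ρ) := e
      _ ≤ ‖φ n‖ₑ ^ ρ * b ^ (1 - ρ) := by
        refine mul_le_mul_right ?_ _
        rw [show (1 - ρ) = -(ρ - 1) by ring, ENNReal.rpow_neg, ENNReal.rpow_neg, ENNReal.inv_le_inv]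
        exact ENNReal.rpow_le_rpow h.le (by linarith)

/-- Exponent bookkeeping behind the splitting of a source in `L^p_t ℓ^ρ`. -/
theorem rpow_mul_rpow_threshold {M A : ℝ≥0∞} (hM : M ≠ 0) (hM' : M ≠ ∞) (hA : A ≠ 0) (hA' : A ≠ ∞)
    (ρ κ e : ℝ) :
    (M * A) ^ ρ * (M * A ^ (1 + κ)) ^ (e - ρ) = M ^ e * A ^ (e + κ * (e - ρ)) := by
  have hx : A ^ (1 + κ) ≠ ∞ := ENNReal.rpow_ne_top_of_ne_zero hA hA'
  rw [ENNReal.mul_rpow_of_ne_top hM' hA', ENNReal.mul_rpow_of_ne_top hM' hx,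
    ← ENNReal.rpow_mul, mul_mul_mul_comm, ← ENNReal.rpow_add _ _ hM hM', ← ENNReal.rpow_add _ _ hA hA']
  congr 2 <;> ring

/-- A source in `L^p_t ℓ^ρ`, `1/p + 1/(4ρ) = 9/8`, is the sum of a part in `L^1_t ℓ²` and a part in
`L^{8/7}_t ℓ¹`. -/
theorem exists_source_splitting {f : ℝ → ℤ → ℂ} (hf : ∀ n, Measurable fun t => f t n) {p ρ : ℝ}
    (hp : 1 ≤ p) (h1 : 1 ≤ ρ) (h2 : ρ ≤ 2) (hpρ : 1 / p + 1 / (4 * ρ) = 9 / 8) {M : ℝ≥0∞}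
    (hM' : M ≠ ∞) (hM : ∫⁻ t, ellNorm (ENNReal.ofReal ρ) (f t) ^ p = M ^ p) :
    ∃ G₁ G₂ : ℝ → EllTwo, StronglyMeasurable G₁ ∧ StronglyMeasurable G₂ ∧
      (∀ᵐ t, ∀ n, ((G₁ t + G₂ t : EllTwo) : ℤ → ℂ) n = f t n) ∧
      ∫⁻ t, ‖G₁ t‖ₑ ≤ M ∧ dualNorm (fun t => ellNorm 1 (G₂ t : ℤ → ℂ)) ≤ M := by
  have hρ : 0 < ρ := by linarith
  have hp0 : 0 < p := by linarith
  set a : ℝ → ℝ≥0∞ := fun t => ellNorm (ENNReal.ofReal ρ) (f t) with ha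
  have ham : Measurable a := measurable_ellNorm_ofReal hf hρ
  rcases eq_or_ne M 0 with rfl | hM0
  · refine ⟨0, 0, stronglyMeasurable_zero, stronglyMeasurable_zero, ?_, by simp, ?_⟩
    · rw [ENNReal.zero_rpow_of_pos hp0, lintegral_eq_zero_iff (ham.pow_const _)] at hM
      filter_upwards [hM] with t ht n
      have h0 : a t = 0 := (ENNReal.rpow_eq_zero_iff_of_pos hp0).1 ht
      have := enorm_le_ellNorm_ofReal hρ (f t) n
      rw [show ellNorm (ENNReal.ofReal ρ) (f t) = 0 from h0] at this
      rw [nonpos_iff_eq_zero, enorm_eq_zero] at this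
      simp [this]
    · have h0 : ellNorm 1 (0 : ℤ → ℂ) = 0 := by rw [ellNorm_one]; simp
      have hz : dualNorm (fun _ : ℝ => ellNorm 1 (0 : ℤ → ℂ)) = 0 := by
        rw [h0]; simp [dualNorm]
      exact hz.le
  set A : ℝ → ℝ≥0∞ := fun t => M⁻¹ * a t with hA
  have hAm : Measurable A := ham.const_mul _
  have haA : ∀ t, a t = M * A t := fun t => by
    simp only [hA]
    rw [← mul_assoc, ENNReal.mul_inv_cancel hM0 hM', one_mul]
  have hAint : ∫⁻ t, A t ^ p = 1 := by
    simp only [hA]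
    simp_rw [ENNReal.mul_rpow_of_nonneg _ _ hp0.le]
    rw [lintegral_const_mul _ (ham.pow_const _), hM, ← ENNReal.mul_rpow_of_nonneg _ _ hp0.le,
      ENNReal.inv_mul_cancel hM0 hM', ENNReal.one_rpow]
  have hAfin : ∀ᵐ t, A t ≠ ∞ := by
    filter_upwards [ae_lt_top (hAm.pow_const p) (by rw [hAint]; simp)] with t ht h
    rw [h, ENNReal.top_rpow_of_pos hp0] at ht
    exact lt_irrefl _ ht
  -- The cut is made at height M·A^{1+κ}. This κ gives the small part ℓ² norm at most M·A^p and the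
  -- large part ℓ¹ norm at most M·A^{7p/8}, so their norms in L¹ and L^{8/7} are both at most M
  -- because A^p has integral 1. That a single κ serves both exponents is the scaling relation
  -- between p and ρ.
  set κ : ℝ := p / (4 * ρ) with hκ
  have hrel : 8 * ρ * 4 + 8 * p = 9 * p * (4 * ρ) := by
    field_simp at hpρ
    linarith
  have hκ2 : 2 + κ * (2 - ρ) = 2 * p := by rw [hκ]; field_simp; linarith
  have hκ1 : 1 + κ * (1 - ρ) = 7 / 8 * p := by rw [hκ]; field_simp; linarith
  have hκ0 : 0 < 1 + κ := by positivity
  set b : ℝ → ℝ≥0∞ := fun t => M * A t ^ (1 + κ) with hb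
  have hbm : Measurable b := (hAm.pow_const _).const_mul _
  set f₁ : ℝ → ℤ → ℂ := fun t n => if ‖f t n‖ₑ ≤ b t then f t n else 0 with hf₁
  set f₂ : ℝ → ℤ → ℂ := fun t n => if ‖f t n‖ₑ ≤ b t then 0 else f t n with hf₂
  have hset : ∀ n, MeasurableSet {t | ‖f t n‖ₑ ≤ b t} := fun n =>
    measurableSet_le (hf n).enorm hbm
  have hf₁m : ∀ n, Measurable fun t => f₁ t n := fun n =>
    Measurable.ite (hset n) (hf n) measurable_const
  have hf₂m : ∀ n, Measurable fun t => f₂ t n := fun n =>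
    Measurable.ite (hset n) measurable_const (hf n)
  have hzero : ∀ t, A t = 0 → ∀ n, f t n = 0 := fun t ht n => by
    have := enorm_le_ellNorm_ofReal hρ (f t) n
    rw [show ellNorm (ENNReal.ofReal ρ) (f t) = a t from rfl, haA, ht, mul_zero] at this
    simpa using this
  have hb₁ : ∀ᵐ t, ellNorm 2 (f₁ t) ≤ M * A t ^ p := by
    filter_upwards [hAfin] with t ht
    rcases eq_or_ne (A t) 0 with h0 | h0
    · have : f₁ t = 0 := by
        ext n
        simp [hf₁, hzero t h0 n]
      rw [this]
      simp [ellNorm_two]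
    · refine (ellNorm_two_small_part_le h1 h2 (f t) (b t)).trans (le_of_eq ?_)
      rw [show ellNorm (ENNReal.ofReal ρ) (f t) = M * A t from haA t,
        rpow_mul_rpow_threshold hM0 hM' h0 ht, hκ2, ENNReal.mul_rpow_of_nonneg _ _ (by norm_num),
        ← ENNReal.rpow_mul, ← ENNReal.rpow_mul]
      norm_num
      congr 2
      ring
  have hb₂ : ∀ᵐ t, ellNorm 1 (f₂ t) ≤ M * A t ^ (7 / 8 * p) := by
    filter_upwards [hAfin] with t ht
    rcases eq_or_ne (A t) 0 with h0 | h0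
    · have : f₂ t = 0 := by
        ext n
        simp [hf₂, hzero t h0 n]
      rw [this]
      simp [ellNorm_one]
    · refine (ellNorm_one_large_part_le h1 (f t) (b := b t) ?_).trans (le_of_eq ?_)
      · exact mul_ne_zero hM0 (by simp [h0, ht])
      · rw [show ellNorm (ENNReal.ofReal ρ) (f t) = M * A t from haA t,
          rpow_mul_rpow_threshold hM0 hM' h0 ht, hκ1, ENNReal.rpow_one]
  have hfin₁ : ∀ᵐ t, ellNorm 2 (f₁ t) < ∞ := by
    filter_upwards [hb₁, hAfin] with t ht hA'
    exact ht.trans_lt (ENNReal.mul_lt_top hM'.lt_top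
      (ENNReal.rpow_lt_top_of_nonneg hp0.le hA'))
  have hfin₂ : ∀ᵐ t, ellNorm 2 (f₂ t) < ∞ := by
    filter_upwards [hb₂, hAfin] with t ht hA'
    have h12 := ellNorm_antitone_ofReal (ρ := 1) (σ := 2) (by norm_num) (by norm_num) (f₂ t)
    rw [ENNReal.ofReal_one, ENNReal.ofReal_ofNat] at h12
    exact (h12.trans ht).trans_lt (ENNReal.mul_lt_top hM'.lt_top
      (ENNReal.rpow_lt_top_of_nonneg (by positivity) hA'))
  obtain ⟨G₁, hG₁m, hG₁⟩ := exists_stronglyMeasurable_of_coords hf₁m hfin₁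
  obtain ⟨G₂, hG₂m, hG₂⟩ := exists_stronglyMeasurable_of_coords hf₂m hfin₂
  refine ⟨G₁, G₂, hG₁m, hG₂m, ?_, ?_, ?_⟩
  · filter_upwards [hG₁, hG₂] with t e1 e2 n
    rw [lp.coeFn_add, Pi.add_apply, e1, e2]
    simp only [hf₁, hf₂]
    split_ifs <;> simp
  · calc ∫⁻ t, ‖G₁ t‖ₑ ≤ ∫⁻ t, M * A t ^ p := by
          refine lintegral_mono_ae ?_
          filter_upwards [hG₁, hb₁] with t e1 hle
          rwa [← ellNorm_two_eq_enorm, e1]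
      _ = M := by rw [lintegral_const_mul _ (hAm.pow_const _), hAint, mul_one]
  · calc dualNorm (fun t => ellNorm 1 (G₂ t : ℤ → ℂ))
        ≤ dualNorm (fun t => M * A t ^ (7 / 8 * p)) := by
          unfold dualNorm
          refine ENNReal.rpow_le_rpow (lintegral_mono_ae ?_) (by norm_num)
          filter_upwards [hG₂, hb₂] with t e2 hle
          rw [e2]
          exact ENNReal.rpow_le_rpow hle (by norm_num)
      _ = M := by
          rw [dualNorm_const_mul _ (hAm.pow_const _), dualNorm]
          simp_rw [← ENNReal.rpow_mul]
          rw [show 7 / 8 * p * (8 / 7) = p by ring, hAint, ENNReal.one_rpow, mul_one]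

/-! ### The Strichartz estimate -/

/-- Measurability of F comes from the equation itself: F equals Δ²u − i∂ₜu almost everywhere, and
derivatives are measurable. -/
theorem IsSolution.aemeasurable_source {u : ℝ → EllTwo} {F : ℝ → ℤ → ℂ} (hu : IsSolution u F)
    (n : ℤ) : AEMeasurable (fun t => F t n) := by
  have h1 : Measurable fun t => (biLaplacian (u t) : ℤ → ℂ) n :=
    ((coord n).continuous.comp (biLaplacian.continuous.comp hu.continuous)).measurable
  have h2 : Measurable (deriv fun s => (u s : ℤ → ℂ) n) := measurable_deriv _
  refine ⟨fun t => (biLaplacian (u t) : ℤ → ℂ) n - Complex.I * deriv (fun s => (u s : ℤ → ℂ) n) t,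
    h1.sub (h2.const_mul _), ?_⟩
  filter_upwards [hu.equation n] with t ⟨v, hv, hv'⟩
  rw [hv.deriv]
  linear_combination hv'

/-- The ℓ² norm is at most the ℓ¹ norm, and y ≤ 1 + y^{8/7} is integrable over bounded intervals. -/
theorem intervalIntegrable_of_dualNorm_ne_top {G : ℝ → EllTwo} (hG : StronglyMeasurable G)
    (h : dualNorm (fun t => ellNorm 1 (G t : ℤ → ℂ)) ≠ ∞) (a b : ℝ) :
    IntervalIntegrable G volume a b := by
  rw [intervalIntegrable_iff]
  refine ⟨hG.aestronglyMeasurable, ?_⟩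
  have hfin : ∫⁻ t, ellNorm 1 (G t : ℤ → ℂ) ^ (8 / 7 : ℝ) ≠ ∞ := fun h0 => h (by
    rw [dualNorm, h0, ENNReal.top_rpow_of_pos (by norm_num)])
  have hle : ∀ t, ‖G t‖ₑ ≤ 1 + ellNorm 1 (G t : ℤ → ℂ) ^ (8 / 7 : ℝ) := fun t => by
    have h12 := ellNorm_antitone_ofReal (ρ := 1) (σ := 2) (by norm_num) (by norm_num)
      (G t : ℤ → ℂ)
    rw [ENNReal.ofReal_one, ENNReal.ofReal_ofNat, ellNorm_two_eq_enorm] at h12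
    refine h12.trans ?_
    rcases le_total (ellNorm 1 (G t : ℤ → ℂ)) 1 with h1 | h1
    · exact le_add_right h1
    · refine le_add_left ?_
      calc ellNorm 1 (G t : ℤ → ℂ) = ellNorm 1 (G t : ℤ → ℂ) ^ (1 : ℝ) := (ENNReal.rpow_one _).symm
        _ ≤ _ := ENNReal.rpow_le_rpow_of_exponent_le h1 (by norm_num)
  refine (lintegral_mono hle).trans_lt ?_
  rw [lintegral_add_left measurable_const]
  refine ENNReal.add_lt_top.2 ⟨?_, (setLIntegral_le_lintegral _ _).trans_lt hfin.lt_top⟩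
  rw [lintegral_const, one_mul, Measure.restrict_apply_univ, Set.uIoc]
  simp

/-- The two endpoint bounds for a solution with a source in `L^p_t ℓ^ρ`,
`1/p + 1/(4ρ) = 9/8`. -/
theorem IsSolution.endpoint_bounds {u : ℝ → EllTwo} {F : ℝ → ℤ → ℂ} (hu : IsSolution u F) {p ρ : ℝ}
    (hp : 1 ≤ p) (h1 : 1 ≤ ρ) (h2 : ρ ≤ 2) (hpρ : 1 / p + 1 / (4 * ρ) = 9 / 8) {M : ℝ≥0∞}
    (hM' : M ≠ ∞) (hM : ∫⁻ t, ellNorm (ENNReal.ofReal ρ) (F t) ^ p = M ^ p) :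
    (∀ t, ‖u t‖ₑ ≤ 186 * (‖u 0‖ₑ + M)) ∧
      ∫⁻ t, ellNorm ∞ (u t : ℤ → ℂ) ^ (8 : ℝ) ≤ (186 * (‖u 0‖ₑ + M)) ^ (8 : ℝ) := by
  set f : ℝ → ℤ → ℂ := fun t n => (hu.aemeasurable_source n).mk _ t with hf
  have hfm : ∀ n, Measurable fun t => f t n := fun n => (hu.aemeasurable_source n).measurable_mk
  have hfF : ∀ᵐ t, ∀ n, F t n = f t n :=
    ae_all_iff.2 fun n => (hu.aemeasurable_source n).ae_eq_mk
  have hMf : ∫⁻ t, ellNorm (ENNReal.ofReal ρ) (f t) ^ p = M ^ p := by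
    rw [← hM]
    refine lintegral_congr_ae ?_
    filter_upwards [hfF] with t ht
    rw [funext ht]
  obtain ⟨G₁, G₂, hm₁, hm₂, hG, hb₁, hb₂⟩ :=
    exists_source_splitting hfm hp h1 h2 hpρ hM' hMf
  have hi₁ : ∀ a b, IntervalIntegrable G₁ volume a b := fun a b =>
    Integrable.intervalIntegrable ⟨hm₁.aestronglyMeasurable, hb₁.trans_lt hM'.lt_top⟩
  have hi₂ := intervalIntegrable_of_dualNorm_ne_top hm₂ (hb₂.trans_lt hM'.lt_top).ne
  have hdu : ∀ T, u T = freeGroup T (u 0 + Complex.I • ∫ s in (0 : ℝ)..T,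
      freeGroup (-s) (G₁ s + G₂ s)) := fun T =>
    hu.duhamel (G := fun s => G₁ s + G₂ s) (fun a b => (hi₁ a b).add (hi₂ a b)) (fun n => by
      filter_upwards [hG, hfF] with t e1 e2
      rw [e1, e2]) T
  -- The common constant is 186 = 26 + 160, needed for the L^8_t ℓ^∞ bound; the other bound would
  -- allow 14.
  constructor
  · intro t
    rw [hdu t]
    refine (enorm_duhamel_le hm₂ hi₁ hi₂ t).trans ?_
    calc ‖u 0‖ₑ + ((∫⁻ s, ‖G₁ s‖ₑ) + 13 * dualNorm fun s => ellNorm 1 (G₂ s : ℤ → ℂ))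
        ≤ ‖u 0‖ₑ + (M + 13 * M) := by gcongr
      _ = 1 * ‖u 0‖ₑ + 14 * M := by ring
      _ ≤ 186 * ‖u 0‖ₑ + 186 * M := by gcongr <;> norm_num
      _ = 186 * (‖u 0‖ₑ + M) := by ring
  · have hum : Measurable fun t => ellNorm ∞ (u t : ℤ → ℂ) :=
      measurable_ellNorm_top hu.continuous.stronglyMeasurable
    refine lintegral_rpow_eight_le_of_test hum fun w hw => ?_
    have := lintegral_mul_ellNorm_top_duhamel_le (u₀ := u 0) hm₁ hm₂ hi₁ hi₂ hw
    simp_rw [← hdu] at this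
    refine this.trans (mul_le_mul_left ?_ _)
    calc 26 * ‖u 0‖ₑ + (26 * (∫⁻ s, ‖G₁ s‖ₑ)
          + 160 * dualNorm fun s => ellNorm 1 (G₂ s : ℤ → ℂ))
        ≤ 26 * ‖u 0‖ₑ + (26 * M + 160 * M) := by gcongr
      _ = 26 * ‖u 0‖ₑ + 186 * M := by ring
      _ ≤ 186 * ‖u 0‖ₑ + 186 * M := by gcongr; norm_num
      _ = 186 * (‖u 0‖ₑ + M) := by ring

/-! ### Interpolation between the endpoints and choice of exponents -/

/-- For finite r, ∑|x|^r ≤ ‖x‖²s^{r−2} with s the supremum. The surplus power 1 − σ − 2/r of s is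
nonnegative and is traded for ‖x‖ ≥ s, which admits an inequality between σ and r in place of the
scaling equality. -/
theorem ellNorm_le_interpolate {r : ℝ≥0∞} (hr : 2 ≤ r) {σ : ℝ} (hσ : 0 ≤ σ)
    (h : σ + 2 * (r⁻¹).toReal ≤ 1) (x : EllTwo) :
    ellNorm r (x : ℤ → ℂ) ≤ ‖x‖ₑ ^ (1 - σ) * ellNorm ∞ (x : ℤ → ℂ) ^ σ := by
  set s := ellNorm ∞ (x : ℤ → ℂ) with hs
  have hsx : s ≤ ‖x‖ₑ := ellNorm_top_le_enorm x
  have hr0 : 0 ≤ (r⁻¹).toReal := ENNReal.toReal_nonneg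
  have hσ1 : 0 ≤ 1 - σ := by linarith
  rcases eq_or_ne r ∞ with rfl | hrt
  · calc s = s ^ (1 - σ) * s ^ σ := by
          rw [← ENNReal.rpow_add_of_nonneg _ _ hσ1 hσ, sub_add_cancel, ENNReal.rpow_one]
      _ ≤ _ := by gcongr
  · obtain ⟨R, rfl⟩ : ∃ R : ℝ, r = ENNReal.ofReal R := ⟨r.toReal, (ENNReal.ofReal_toReal hrt).symm⟩
    have hR : 2 ≤ R := by
      rw [show (2 : ℝ≥0∞) = ENNReal.ofReal 2 by norm_num] at hr
      by_contra! hlt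
      exact absurd hr (not_le.2 (ENNReal.ofReal_lt_ofReal_iff (by norm_num) |>.2 hlt))
    have hR0 : 0 < R := by linarith
    rw [ENNReal.toReal_inv, ENNReal.toReal_ofReal hR0.le] at h
    have hle : ∑' n, ‖(x : ℤ → ℂ) n‖ₑ ^ R ≤ ‖x‖ₑ ^ (2 : ℝ) * s ^ (R - 2) := by
      have h2 : ‖x‖ₑ ^ (2 : ℝ) = ∑' n, ‖(x : ℤ → ℂ) n‖ₑ ^ (2 : ℝ) := by
        rw [← ellNorm_two_eq_enorm, ellNorm_two, ← ENNReal.rpow_mul]; norm_num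
      rw [h2, ← ENNReal.tsum_mul_right]
      refine ENNReal.tsum_le_tsum fun n => ?_
      have e : ‖(x : ℤ → ℂ) n‖ₑ ^ R = ‖(x : ℤ → ℂ) n‖ₑ ^ (2 : ℝ) * ‖(x : ℤ → ℂ) n‖ₑ ^ (R - 2) := by
        rw [← ENNReal.rpow_add_of_nonneg _ _ (by norm_num) (by linarith), add_sub_cancel]
      have hn : ‖(x : ℤ → ℂ) n‖ₑ ≤ s := by
        rw [hs, ellNorm_top]; exact le_iSup (fun n => ‖(x : ℤ → ℂ) n‖ₑ) n
      have h3 : 0 ≤ R - 2 := by linarith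
      rw [e]
      gcongr
    have hexp : (R - 2) * (1 / R) = σ + (1 - σ - 2 * R⁻¹) := by field_simp; ring
    have hg : 0 ≤ 1 - σ - 2 * R⁻¹ := by linarith
    rw [ellNorm_ofReal hR0]
    calc (∑' n, ‖(x : ℤ → ℂ) n‖ₑ ^ R) ^ (1 / R) ≤ (‖x‖ₑ ^ (2 : ℝ) * s ^ (R - 2)) ^ (1 / R) := by
          gcongr
      _ = ‖x‖ₑ ^ (2 * R⁻¹) * (s ^ σ * s ^ (1 - σ - 2 * R⁻¹)) := by
          rw [ENNReal.mul_rpow_of_nonneg _ _ (by positivity), ← ENNReal.rpow_mul,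
            ← ENNReal.rpow_mul, hexp, ENNReal.rpow_add_of_nonneg _ _ hσ hg, one_div]
      _ ≤ ‖x‖ₑ ^ (2 * R⁻¹) * (s ^ σ * ‖x‖ₑ ^ (1 - σ - 2 * R⁻¹)) := by gcongr
      _ = ‖x‖ₑ ^ (1 - σ) * s ^ σ := by
          rw [mul_left_comm, mul_comm (s ^ σ), ← ENNReal.rpow_add_of_nonneg _ _ (by positivity) hg]
          congr 2
          ring

theorem Admissible.toReal_le {q r : ℝ≥0∞} (h : Admissible q r) :
    8 * (q⁻¹).toReal + 2 * (r⁻¹).toReal ≤ 1 := by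
  obtain ⟨hq, hr, -, h⟩ := h
  have hq0 : q ≠ 0 := (lt_of_lt_of_le (by norm_num) hq).ne'
  have hr0 : r ≠ 0 := (lt_of_lt_of_le (by norm_num) hr).ne'
  have h' := ENNReal.toReal_mono (by norm_num) h
  rw [one_div, one_div, ENNReal.toReal_add (by simpa using hq0) (by simp [hr0]),
    ENNReal.mul_inv (by simp) (by simp), ENNReal.toReal_mul] at h'
  rw [ENNReal.toReal_inv q, ENNReal.toReal_inv r]
  norm_num at h'
  linarith

/-- Interpolating at each time with σ = 8/q makes the q-th power of the ℓ^∞ factor exactly its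
eighth power, which integrates; the other factor is bounded uniformly in time. -/
theorem mixedNorm_le_of_endpoints {u : ℝ → EllTwo} (hu : Continuous u) {q r : ℝ≥0∞} (h : Admissible q r) {Y : ℝ≥0∞}
    (h1 : ∀ t, ‖u t‖ₑ ≤ Y) (h2 : ∫⁻ t, ellNorm ∞ (u t : ℤ → ℂ) ^ (8 : ℝ) ≤ Y ^ (8 : ℝ)) :
    mixedNorm q r (fun t => (u t : ℤ → ℂ)) ≤ Y := by
  have hqr := h.toReal_le
  obtain ⟨hq, hr, -, -⟩ := h
  have hr0 : 0 ≤ (r⁻¹).toReal := ENNReal.toReal_nonneg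
  have hpt := fun t => ellNorm_le_interpolate hr (σ := 8 * (q⁻¹).toReal) (by positivity) hqr (u t)
  rw [mixedNorm]
  rcases eq_or_ne q ∞ with rfl | hqt
  · rw [eLpNorm_exponent_top]
    refine essSup_le_of_ae_le _ (Filter.Eventually.of_forall fun t => ?_)
    have := hpt t
    simp only [ENNReal.inv_top, ENNReal.toReal_zero, mul_zero, sub_zero, ENNReal.rpow_one,
      ENNReal.rpow_zero, mul_one] at this
    exact this.trans (h1 t)
  · have hq0 : q ≠ 0 := (lt_of_lt_of_le (by norm_num) hq).ne'
    set Q := q.toReal with hQ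
    have hQ0 : 0 < Q := ENNReal.toReal_pos hq0 hqt
    rw [ENNReal.toReal_inv, ← hQ] at hqr hpt
    have hQ8 : 8 * Q⁻¹ ≤ 1 := by linarith
    have hQ8' : 0 ≤ Q - 8 := by
      have := mul_le_mul_of_nonneg_right hQ8 hQ0.le
      rw [mul_assoc, inv_mul_cancel₀ hQ0.ne'] at this
      linarith
    rw [eLpNorm_eq_lintegral_rpow_enorm_toReal hq0 hqt]
    simp only [enorm_eq_self]
    have hle : ∫⁻ t, ellNorm r (u t : ℤ → ℂ) ^ Q ≤ Y ^ Q := by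
      calc ∫⁻ t, ellNorm r (u t : ℤ → ℂ) ^ Q
          ≤ ∫⁻ t, Y ^ (Q - 8) * ellNorm ∞ (u t : ℤ → ℂ) ^ (8 : ℝ) := by
            refine lintegral_mono fun t => ?_
            calc ellNorm r (u t : ℤ → ℂ) ^ Q
                ≤ (Y ^ (1 - 8 * Q⁻¹) * ellNorm ∞ (u t : ℤ → ℂ) ^ (8 * Q⁻¹)) ^ Q := by
                  refine ENNReal.rpow_le_rpow ((hpt t).trans ?_) hQ0.le
                  have := h1 t
                  have h0 : 0 ≤ 1 - 8 * Q⁻¹ := by linarith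
                  gcongr
              _ = Y ^ (Q - 8) * ellNorm ∞ (u t : ℤ → ℂ) ^ (8 : ℝ) := by
                  rw [ENNReal.mul_rpow_of_nonneg _ _ hQ0.le, ← ENNReal.rpow_mul,
                    ← ENNReal.rpow_mul]
                  congr 2 <;> field_simp
        _ = Y ^ (Q - 8) * ∫⁻ t, ellNorm ∞ (u t : ℤ → ℂ) ^ (8 : ℝ) := by
            exact lintegral_const_mul _
              ((measurable_ellNorm_top hu.stronglyMeasurable).pow_const _)
        _ ≤ Y ^ (Q - 8) * Y ^ (8 : ℝ) := by gcongr
        _ = Y ^ Q := by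
            rw [← ENNReal.rpow_add_of_nonneg _ _ hQ8' (by norm_num), sub_add_cancel]
    calc _ ≤ (Y ^ Q) ^ (1 / Q) := by gcongr
      _ = Y := by rw [← ENNReal.rpow_mul, mul_one_div_cancel hQ0.ne', ENNReal.rpow_one]

theorem toReal_inv_conjExponent {q : ℝ≥0∞} (hq : 2 ≤ q) :
    q.conjExponent ≠ ∞ ∧ q.conjExponent.toReal⁻¹ = 1 - (q⁻¹).toReal := by
  have h1 : 1 ≤ q := le_trans (by norm_num) hq
  have hq0 : q ≠ 0 := (lt_of_lt_of_le (by norm_num) hq).ne'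
  have hc := ENNReal.HolderConjugate.conjExponent h1
  have hsum : q⁻¹ + q.conjExponent⁻¹ = 1 := hc.inv_add_inv_eq_one
  have hne : q.conjExponent ≠ 0 := by rw [ENNReal.conjExponent]; simp
  refine ⟨?_, ?_⟩
  · rw [ENNReal.conjExponent]
    refine ENNReal.add_ne_top.2 ⟨by simp, ?_⟩
    rw [ENNReal.inv_ne_top]
    exact (tsub_pos_of_lt (lt_of_lt_of_le (by norm_num) hq)).ne'
  · have := congrArg ENNReal.toReal hsum
    rw [ENNReal.toReal_add (by simpa using hq0) (by simpa using hne), ENNReal.toReal_one,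
      ENNReal.toReal_inv q.conjExponent] at this
    linarith

theorem exists_strichartz_const {q r q₁ r₁ : ℝ≥0∞} (h : Admissible q r) (h₁ : Admissible q₁ r₁) :
    ∃ C : ℝ≥0, ∀ (u : ℝ → EllTwo) (F : ℝ → ℤ → ℂ), IsSolution u F →
      mixedNorm q r (fun t => (u t : ℤ → ℂ))
        ≤ (C : ℝ≥0∞) * (ellNorm 2 (u 0 : ℤ → ℂ)
            + mixedNorm q₁.conjExponent r₁.conjExponent F) := by
  refine ⟨186, fun u F hu => ?_⟩
  have hqr := h₁.toReal_le
  obtain ⟨hq, hr, -, -⟩ := h₁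
  obtain ⟨hqt, hqi⟩ := toReal_inv_conjExponent hq
  obtain ⟨hrt, hri⟩ := toReal_inv_conjExponent hr
  rw [ellNorm_two_eq_enorm]
  set N := mixedNorm q₁.conjExponent r₁.conjExponent F with hN
  rcases eq_or_ne N ∞ with hNt | hNt
  · rw [hNt, add_top, ENNReal.mul_top (by norm_num)]; exact le_top
  set p := q₁.conjExponent.toReal with hp
  set ρ₁ := r₁.conjExponent.toReal with hρ₁
  have hx : 0 ≤ (q₁⁻¹).toReal := ENNReal.toReal_nonneg
  have hy : 0 ≤ (r₁⁻¹).toReal := ENNReal.toReal_nonneg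
  have hp0 : 0 < p := by rw [← inv_pos, hqi]; linarith
  have hρ₁0 : 0 < ρ₁ := by rw [← inv_pos, hri]; linarith
  have hp1 : 1 ≤ p := by
    rw [← inv_le_one₀ hp0, hqi]; linarith
  -- The space exponent is moved to the scaling line while p is kept: 1/ρ = 1/2 + 4/q₁ makes 1/p +
  -- 1/(4ρ) = 9/8. Admissibility says that the dual of r₁ is at most ρ, so the ℓ^ρ norm of the
  -- source is the smaller one.
  set ρ : ℝ := (1 / 2 + 4 * (q₁⁻¹).toReal)⁻¹ with hρ
  have hρ0 : 0 < ρ := by positivity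
  have hρi : ρ⁻¹ = 1 / 2 + 4 * (q₁⁻¹).toReal := by rw [hρ, inv_inv]
  have hρ1 : 1 ≤ ρ := by rw [← inv_le_one₀ hρ0, hρi]; linarith
  have hρ2 : ρ ≤ 2 := by
    rw [← inv_le_inv₀ (by norm_num) hρ0, hρi]; linarith
  have hle : ρ₁ ≤ ρ := by
    rw [← inv_le_inv₀ hρ0 hρ₁0, hρi, hri]; linarith
  have hpρ : 1 / p + 1 / (4 * ρ) = 9 / 8 := by
    rw [one_div, one_div, mul_inv, hqi, hρi]; ring
  set M := (∫⁻ t, ellNorm (ENNReal.ofReal ρ) (F t) ^ p) ^ (1 / p) with hM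
  have hMN : M ≤ N := by
    have hNe : N = (∫⁻ t, ellNorm r₁.conjExponent (F t) ^ p) ^ (1 / p) := by
      rw [hN, mixedNorm, eLpNorm_eq_lintegral_rpow_enorm_toReal
        (by rw [ENNReal.conjExponent]; simp) hqt]
      simp only [enorm_eq_self, ← hp]
    rw [hNe, hM]
    gcongr with t
    rw [← ENNReal.ofReal_toReal hrt]
    exact ellNorm_antitone_ofReal hρ₁0 hle _
  have hMp : ∫⁻ t, ellNorm (ENNReal.ofReal ρ) (F t) ^ p = M ^ p := by
    rw [hM, ← ENNReal.rpow_mul, one_div_mul_cancel hp0.ne', ENNReal.rpow_one]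
  obtain ⟨b1, b2⟩ := hu.endpoint_bounds hp1 hρ1 hρ2 hpρ (hMN.trans_lt hNt.lt_top).ne hMp
  refine (mixedNorm_le_of_endpoints hu.continuous h b1 b2).trans ?_
  have : ((186 : ℝ≥0) : ℝ≥0∞) = 186 := by norm_num
  rw [this]
  gcongr

end
end BiSchrodinger

theorem theorem3p4 :
    (∀ q r q₁ r₁ : ENNReal, BiSchrodinger.Admissible q r → BiSchrodinger.Admissible q₁ r₁ →
      ∃ C : NNReal, ∀ (u : ℝ → BiSchrodinger.EllTwo) (F : ℝ → ℤ → ℂ),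
        BiSchrodinger.IsSolution u F →
          BiSchrodinger.mixedNorm q r (fun t => (u t : ℤ → ℂ))
            ≤ (C : ENNReal) * (BiSchrodinger.ellNorm 2 (u 0 : ℤ → ℂ)
                + BiSchrodinger.mixedNorm q₁.conjExponent r₁.conjExponent F)) ∧
    IsGreatest {α : ℝ | BiSchrodinger.DecayEstimate α} (1 / 4) :=
  ⟨fun _ _ _ _ h h₁ => BiSchrodinger.exists_strichartz_const h h₁,
    BiSchrodinger.isGreatest_decayEstimate⟩
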